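/- Let $0\le\alpha<1$. For $\beta\in\mathbb R$, $E<0$, $t>0$ and $u\in\mathbb C$ put $$\tilde S(u,\xi;E)=(\xi^3+\bar\xi^3)\Big(1-\frac{3E}{|\xi|^2}\Big)+\tfrac12(\bar u\xi+u\bar\xi),$$ $$I(t,u;E)=\int_{\mathbb C}|\xi|^{\alpha+i\beta}\,e^{it\tilde S(u,\xi;E)}\,d\operatorname{Re}\xi\,d\operatorname{Im}\xi:=\lim_{R\to\infty}\int_{|\xi|<R}|\xi|^{\alpha+i\beta}\,e^{it\tilde S(u,\xi;E)}\,d\operatorname{Re}\xi\,d\operatorname{Im}\xi .$$ Then there is $\varepsilon_0=\varepsilon_0(\alpha)>0$ such that for every $0<\varepsilon<\varepsilon_0$ there is a constant $C>0$, depending only on $\alpha$ and $\varepsilon$, such that for all $\beta\in\mathbb R$, all $t>0$ and all $u\in\mathbb C$ the limit defining $I(t,u;-1)$ exists and $$|I(t,u;-1)|\le C\,\frac{1+|\beta|}{t^{(\alpha+3)/4-\varepsilon}}.$$ Moreover, with the same constant $C$, for every $E<0$ the limit defining $I(t,u;E)$ exists and $$|I(t,u;E)|\le C\,\frac{(1+|\beta|)\,|E|^{(\alpha-1)/8+3\varepsilon/2}}{t^{(\alpha+3)/4-\varepsilon}}.$$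 -/

import Mathlib

open Filter Topology MeasureTheory ComplexConjugate

noncomputable section

/-- The symbol `p(ξ) = (ξ³ + ξ̄³)(1 - 3E/|ξ|²)` of the linear part of the Novikov-Veselov
equation at energy `E` (it is real valued; its value at `ξ = 0` is irrelevant). -/
def nvSymbol (E : ℝ) (ξ : ℂ) : ℂ :=
  (ξ ^ 3 + conj ξ ^ 3) * (1 - 3 * (E : ℂ) / ((‖ξ‖ : ℝ) : ℂ) ^ 2)

/-- The phase `S̃(u, ξ; E) = p(ξ) + (ū ξ + u ξ̄) / 2`. -/
def nvPhase (E : ℝ) (u ξ : ℂ) : ℂ :=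
  nvSymbol E ξ + 1 / 2 * (conj u * ξ + u * conj ξ)

/-- The integrand `|ξ|^(α + iβ) exp(i t S̃(u, ξ; E))`. -/
def nvIntegrand (α β E t : ℝ) (u ξ : ℂ) : ℂ :=
  ((‖ξ‖ : ℝ) : ℂ) ^ ((α : ℂ) + Complex.I * (β : ℂ)) *
    Complex.exp (Complex.I * (t : ℂ) * nvPhase E u ξ)

/-- The integral truncated to the disc `|ξ| < R`, with respect to `dRe ξ dIm ξ`. For `0 ≤ α` the
integrand is bounded on the disc, so this is an absolutely convergent integral. -/
def nvTruncatedIntegral (α β E t : ℝ) (u : ℂ) (R : ℝ) : ℂ :=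
  ∫ ξ in Metric.ball (0 : ℂ) R, nvIntegrand α β E t u ξ

/-- The oscillatory integral `I(t, u; E)`. The integrand is not absolutely integrable over the
plane, so the integral is the improper one: the limit, as `R → ∞`, of the integrals over the
discs `|ξ| < R`. (This definition is meaningful when that limit exists, which is asserted
separately wherever it is used.) -/
def nvOscillatoryIntegral (α β E t : ℝ) (u : ℂ) : ℂ :=
  limUnder atTop (nvTruncatedIntegral α β E t u)

end

/-! At energy `-1`, substitute `ξ = 2 sinh σ · e^{iθ}`. With `w = σ + iθ` on a half cylinder, the
phase becomes `Re Φ(w)` with `Φ` holomorphic (`nvPhase_sinh`), and the critical points are the zeros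
of `g = Φ'`. Since `dbar e^{it Re Φ} = i t ḡ e^{it Re Φ}`, one would like to integrate by parts
against `1 / ḡ`, which is singular at those zeros.

The multiplier used instead is `1 / M = g / (|g|² + P / t²)`, where `P^{-1/2}` is comparable to the
least of `τ = 1 - e^{-2σ}` and the factors `|1 - z_k e^{-2w}|` of `g`. Logarithmic derivatives of
`g`, `P`, `M` and the amplitude `A` cost at most a multiple of `√P` (times `1 + |β|` for `A`). With
`q = √P / (t|g|)` the remainder is therefore at most `C (1 + |β|) |A| q^κ` for every `0 ≤ κ ≤ 1`
(`differentiableAt_nvF_and_norm_sub_le`), which produces the decay `t^{-κ}`.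

It remains to integrate `|A| (√P / |g|)^κ` uniformly in `u` (`exists_weight_majorant`). The cubic
behind `g` is symmetric under reflection in the unit circle, so at most one root lies outside the
disc (`exists_isNVRoots`); the other two factors are at least `τ`, and the vanishing of `A` at `σ =
0` compensates them. What remains is a sum of terms `e^{-(3κ-2-α)σ} |1 - z_k e^{-2w}|^{-(4κ-1-α)}`.
The singularity is integrable when `κ < (3 + α) / 4`, the tail when `κ > (2 + α) / 3`; both hold for
`κ = (α + 3) / 4 - ε` with `ε` small.

The boundary terms vanish (`setIntegral_cylRect_eq`, `tendsto_boundary`), so the truncated integrals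
converge to the integral of the remainder. Dilating `ξ` by `√(-E)` gives every other negative
energy. -/

/-! ### Calculus of the operator `∂₁ + i ∂₂`. -/

/-- The operator `∂₁ + i ∂₂` on complex valued functions of two real variables. -/
noncomputable def dbar (f : ℝ × ℝ → ℂ) (x : ℝ × ℝ) : ℂ :=
  fderiv ℝ f x (1, 0) + Complex.I * fderiv ℝ f x (0, 1)

/-- `f` is real differentiable at `x` and `(∂₁ + i ∂₂) f x = d`. -/
structure HasDbarAt (f : ℝ × ℝ → ℂ) (d : ℂ) (x : ℝ × ℝ) : Prop where
  differentiableAt : DifferentiableAt ℝ f x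
  dbar_eq : dbar f x = d

/-- The point `σ + i θ`. -/
noncomputable def cylPoint (x : ℝ × ℝ) : ℂ := (x.1 : ℂ) + (x.2 : ℂ) * Complex.I

lemma measurable_dbar (f : ℝ × ℝ → ℂ) : Measurable (dbar f) :=
  (measurable_fderiv_apply_const ℝ f _).add
    ((measurable_fderiv_apply_const ℝ f _).const_mul _)

namespace HasDbarAt

variable {f g : ℝ × ℝ → ℂ} {c d : ℂ} {x : ℝ × ℝ}

lemma of_hasFDerivAt {f' : ℝ × ℝ →L[ℝ] ℂ} (h : HasFDerivAt f f' x)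
    (hd : f' (1, 0) + Complex.I * f' (0, 1) = d) : HasDbarAt f d x :=
  ⟨h.differentiableAt, by rw [dbar, h.fderiv, hd]⟩

lemma add (hf : HasDbarAt f c x) (hg : HasDbarAt g d x) :
    HasDbarAt (fun y => f y + g y) (c + d) x := by
  refine of_hasFDerivAt (hf.1.hasFDerivAt.add hg.1.hasFDerivAt) ?_
  rw [← hf.2, ← hg.2, dbar, dbar]
  simp only [add_apply]
  ring

lemma mul (hf : HasDbarAt f c x) (hg : HasDbarAt g d x) :
    HasDbarAt (fun y => f y * g y) (c * g x + f x * d) x := by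
  refine of_hasFDerivAt (hf.1.hasFDerivAt.mul hg.1.hasFDerivAt) ?_
  rw [← hf.2, ← hg.2, dbar, dbar]
  simp only [add_apply, smul_apply, smul_eq_mul]
  ring

lemma sum {ι : Type*} {s : Finset ι} {F : ι → ℝ × ℝ → ℂ} {D : ι → ℂ}
    (h : ∀ i ∈ s, HasDbarAt (F i) (D i) x) :
    HasDbarAt (fun y => ∑ i ∈ s, F i y) (∑ i ∈ s, D i) x := by
  refine of_hasFDerivAt (HasFDerivAt.fun_sum fun i hi => (h i hi).1.hasFDerivAt) ?_
  simp only [sum_apply, Finset.mul_sum, ← Finset.sum_add_distrib]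
  exact Finset.sum_congr rfl fun i hi => (h i hi).2

/-- The chain rule for an outer holomorphic function. -/
lemma holo_comp {h : ℂ → ℂ} {h' : ℂ} (hh : HasDerivAt h h' (f x)) (hf : HasDbarAt f d x) :
    HasDbarAt (fun y => h (f y)) (h' * d) x := by
  have h1 : HasFDerivAt (𝕜 := ℝ) h _ (f x) := hh.hasFDerivAt.restrictScalars ℝ
  refine of_hasFDerivAt (h1.comp x hf.1.hasFDerivAt) ?_
  rw [← hf.2, dbar]
  simp [mul_comm, mul_add, mul_left_comm]

lemma inv (hf : HasDbarAt f d x) (h0 : f x ≠ 0) :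
    HasDbarAt (fun y => (f y)⁻¹) (-d / f x ^ 2) x := by
  convert hf.holo_comp (hasDerivAt_inv h0) using 1
  ring

lemma const (c : ℂ) : HasDbarAt (fun _ => c) 0 x :=
  of_hasFDerivAt (hasFDerivAt_const c x) (by simp)

lemma congr_value (hf : HasDbarAt f c x) (h : c = d) : HasDbarAt f d x := h ▸ hf

end HasDbarAt

lemma hasFDerivAt_cylPoint (x : ℝ × ℝ) :
    HasFDerivAt cylPoint (Complex.ofRealCLM.comp (ContinuousLinearMap.fst ℝ ℝ ℝ) +
      (Complex.ofRealCLM.comp (ContinuousLinearMap.snd ℝ ℝ ℝ)).smulRight Complex.I) x := by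
  have := (Complex.ofRealCLM.comp (ContinuousLinearMap.fst ℝ ℝ ℝ) +
      (Complex.ofRealCLM.comp (ContinuousLinearMap.snd ℝ ℝ ℝ)).smulRight Complex.I).hasFDerivAt
      (x := x)
  refine this.congr_of_eventuallyEq (Eventually.of_forall fun y => ?_)
  simp [cylPoint]

lemma hasDbarAt_cylPoint (x : ℝ × ℝ) : HasDbarAt cylPoint 0 x :=
  .of_hasFDerivAt (hasFDerivAt_cylPoint x) (by simp)

lemma hasDbarAt_conj_cylPoint (x : ℝ × ℝ) :
    HasDbarAt (fun y => conj (cylPoint y)) 2 x := by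
  have h : HasFDerivAt (𝕜 := ℝ) (fun z : ℂ => conj z) (Complex.conjCLE : ℂ →L[ℝ] ℂ)
    (cylPoint x) := Complex.conjCLE.hasFDerivAt
  refine .of_hasFDerivAt (h.comp x (hasFDerivAt_cylPoint x)) ?_
  simp
  norm_num

lemma hasDbarAt_holo {h : ℂ → ℂ} {h' : ℂ} {x : ℝ × ℝ} (hh : HasDerivAt h h' (cylPoint x)) :
    HasDbarAt (fun y => h (cylPoint y)) 0 x :=
  ((hasDbarAt_cylPoint x).holo_comp hh).congr_value (by simp)

lemma hasDbarAt_conj_holo {h : ℂ → ℂ} {h' : ℂ} {x : ℝ × ℝ}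
    (hh : HasDerivAt h h' (cylPoint x)) :
    HasDbarAt (fun y => conj (h (cylPoint y))) (2 * conj h') x := by
  have h1 : HasDerivAt (fun z => conj (h (conj z))) (conj h') (conj (cylPoint x)) := by
    have := hh.conj_conj
    simpa [Function.comp_def] using this
  have := (hasDbarAt_conj_cylPoint x).holo_comp h1
  simp only [Complex.conj_conj] at this
  exact this.congr_value (mul_comm _ _)

lemma hasDbarAt_fst {a : ℝ → ℂ} {a' : ℂ} {x : ℝ × ℝ} (ha : HasDerivAt a a' x.1) :
    HasDbarAt (fun y => a y.1) a' x := by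
  refine .of_hasFDerivAt (ha.hasFDerivAt.comp x (hasFDerivAt_fst (𝕜 := ℝ) (p := x))) ?_
  simp

/-! ### Phase and amplitude on the cylinder, and the roots of the cubic. -/

/-- A holomorphic function on the cylinder `σ + iθ` whose real part is the phase. -/
noncomputable def nvPhi (u w : ℂ) : ℂ :=
  2 * (Complex.exp (3 * w) - Complex.exp (-(3 * w))) + conj u * Complex.exp w -
    u * Complex.exp (-w)

/-- The derivative of `nvPhi`. -/
noncomputable def nvG (u w : ℂ) : ℂ :=
  6 * (Complex.exp (3 * w) + Complex.exp (-(3 * w))) + conj u * Complex.exp w +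
    u * Complex.exp (-w)

/-- The linear factor `1 - z e^{-2w}`. -/
noncomputable def nvY (z w : ℂ) : ℂ := 1 - z * Complex.exp (-(2 * w))

/-- Plays the role of the distance to the boundary circle `σ = 0`, bounded by `1` at infinity; it is
the factor `|1 - z e^{-2w}|` at its smallest for `‖z‖ = 1`. -/
noncomputable def nvTau (σ : ℝ) : ℝ := 1 - Real.exp (-(2 * σ))

/-- An inverse squared distance to the zeros of `nvG` and to the boundary of the cylinder. -/
noncomputable def nvP (z : Fin 3 → ℂ) (x : ℝ × ℝ) : ℝ :=
  (nvTau x.1 ^ 2)⁻¹ + ∑ k, (‖nvY (z k) (cylPoint x)‖ ^ 2)⁻¹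

/-- The amplitude of the oscillatory integral, Jacobian included, in cylinder coordinates. -/
noncomputable def nvAmp (α β σ : ℝ) : ℂ :=
  ((2 * Real.sinh σ : ℝ) : ℂ) ^ ((α : ℂ) + Complex.I * (β : ℂ)) *
    ((2 * Real.sinh (2 * σ) : ℝ) : ℂ)

/-- A factorization of `nvG u` with at most one of the roots outside the unit disc. -/
structure IsNVRoots (u : ℂ) (z : Fin 3 → ℂ) : Prop where
  eq_prod : ∀ w, nvG u w = 6 * Complex.exp (3 * w) * ∏ k, nvY (z k) w
  ne_zero : ∀ k, z k ≠ 0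
  norm_one_le : ‖z 1‖ ≤ 1
  norm_two_le : ‖z 2‖ ≤ 1

lemma exists_quadratic_factor (b c : ℂ) :
    ∃ r s : ℂ, ∀ z : ℂ, z ^ 2 + b * z + c = (z - r) * (z - s) := by
  obtain ⟨d, hd⟩ := IsAlgClosed.exists_pow_nat_eq (b ^ 2 - 4 * c) (n := 2) (by norm_num)
  refine ⟨(-b + d) / 2, (-b - d) / 2, fun z => ?_⟩
  linear_combination hd / 4

lemma exists_cubic_factor (a b c : ℂ) :
    ∃ r s q : ℂ, ∀ z : ℂ, z ^ 3 + a * z ^ 2 + b * z + c = (z - r) * (z - s) * (z - q) := by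
  open Polynomial in
  obtain ⟨r, hr⟩ := IsAlgClosed.exists_root (X ^ 3 + C a * X ^ 2 + C b * X + C c : ℂ[X]) (by
    have : (X ^ 3 + C a * X ^ 2 + C b * X + C c : ℂ[X]).degree = 3 := by compute_degree!
    rw [this]; norm_num)
  have hr' : r ^ 3 + a * r ^ 2 + b * r + c = 0 := by
    simpa [Polynomial.IsRoot] using hr
  obtain ⟨s, q, h⟩ := exists_quadratic_factor (a + r) (b + a * r + r ^ 2)
  refine ⟨r, s, q, fun z => ?_⟩
  rw [mul_assoc, ← h z]
  linear_combination hr'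

/-- In the variable `e^{2w}`, `nvG u` is a cubic whose root set is invariant under `a ↦ 1 / ā` and
whose roots have product `-1`. This rules out two roots outside the closed disc; the possible
exceptional one is listed first. -/
lemma exists_isNVRoots (u : ℂ) : ∃ z, IsNVRoots u z := by
  have main : ∃ r s q : ℂ, (∀ z : ℂ, z ^ 3 + conj u / 6 * z ^ 2 + u / 6 * z + 1 =
      (z - r) * (z - s) * (z - q)) ∧ ‖s‖ ≤ 1 ∧ ‖q‖ ≤ 1 := by
    obtain ⟨r, s, q, h⟩ := exists_cubic_factor (conj u / 6) (u / 6) 1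
    have hp : r * s * q = -1 := by linear_combination h 0
    have hroot : ∀ a : ℂ, a ≠ 0 → (a - r) * (a - s) * (a - q) = 0 →
        ((conj a)⁻¹ - r) * ((conj a)⁻¹ - s) * ((conj a)⁻¹ - q) = 0 := by
      intro a ha h0
      rw [← h] at h0 ⊢
      have hc : conj a ≠ 0 := by simpa using ha
      have := congrArg conj h0
      simp only [map_add, map_mul, map_pow, map_div₀, Complex.conj_conj, map_one, map_zero,
        map_ofNat] at this
      field_simp
      linear_combination 6 * this
    -- If `a` and `b` both lie outside the disc, their reflections lie inside and must both be `c`;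
    -- then `‖a‖‖c‖ = 1`, and the product relation forces `‖b‖ = 1`.
    have key : ∀ a b c : ℂ, a * b * c = -1 → (∀ x : ℂ, x ≠ 0 → (x - a) * (x - b) * (x - c) = 0 →
        ((conj x)⁻¹ - a) * ((conj x)⁻¹ - b) * ((conj x)⁻¹ - c) = 0) →
        1 < ‖a‖ → 1 < ‖b‖ → False := by
      intro a b c hp hr ha hb
      have aux : ∀ x : ℂ, 1 < ‖x‖ → (x - a) * (x - b) * (x - c) = 0 → (conj x)⁻¹ = c := by
        intro x hx h0
        have hn : ‖(conj x)⁻¹‖ < 1 := by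
          rw [norm_inv, RCLike.norm_conj]
          exact inv_lt_one_of_one_lt₀ hx
        have := hr x (by rintro rfl; simp at hx; linarith) h0
        rcases mul_eq_zero.1 this with h1 | h1
        · rcases mul_eq_zero.1 h1 with h2 | h2
          · rw [sub_eq_zero.1 h2] at hn; linarith
          · rw [sub_eq_zero.1 h2] at hn; linarith
        · exact sub_eq_zero.1 h1
      have e1 := aux a ha (by simp)
      have e2 := aux b hb (by simp)
      have e3 : ‖a‖ * ‖b‖ * ‖c‖ = 1 := by rw [← norm_mul, ← norm_mul, hp]; simp
      rw [← e1, norm_inv, RCLike.norm_conj] at e3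
      have : ‖a‖ ≠ 0 := by positivity
      field_simp at e3
      linarith
    have k1 := key r s q hp hroot
    have k2 := key r q s (by linear_combination hp) (fun x hx h0 => by
      have := hroot x hx (by linear_combination h0); linear_combination this)
    have k3 := key s q r (by linear_combination hp) (fun x hx h0 => by
      have := hroot x hx (by linear_combination h0); linear_combination this)
    by_cases hr : 1 < ‖r‖
    · exact ⟨r, s, q, h, not_lt.1 (k1 hr), not_lt.1 (k2 hr)⟩
    · by_cases hs : 1 < ‖s‖
      · exact ⟨s, r, q, fun z => by rw [h]; ring, not_lt.1 hr, not_lt.1 (k3 hs)⟩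
      · exact ⟨q, r, s, fun z => by rw [h]; ring, not_lt.1 hr, not_lt.1 hs⟩
  obtain ⟨r, s, q, h, hs, hq⟩ := main
  have hp : r * s * q = -1 := by linear_combination h 0
  refine ⟨![r, s, q], fun w => ?_, fun k => ?_, hs, hq⟩
  · have e := Complex.exp_ne_zero w
    simp only [nvG, nvY, Fin.prod_univ_three, Complex.exp_neg, Complex.exp_nat_mul w 3,
      show (3 : ℂ) * w = ((3 : ℕ) : ℂ) * w by norm_num,
      show (2 : ℂ) * w = ((2 : ℕ) : ℂ) * w by norm_num, Complex.exp_nat_mul w 2]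
    have := h (Complex.exp w ^ 2)
    simp only [Matrix.cons_val_zero, Matrix.cons_val_one, Matrix.cons_val]
    field_simp
    field_simp at this
    linear_combination this
  · fin_cases k <;> simp <;> rintro rfl <;> simp at hp

/-! ### Logarithmic derivatives of `nvG` and `nvP`. -/

section pointwise

variable {u : ℂ} {z : Fin 3 → ℂ} {x : ℝ × ℝ}

lemma hasDerivAt_nvY (a w : ℂ) : HasDerivAt (nvY a) (2 * (1 - nvY a w)) w := by
  have h : HasDerivAt (fun w : ℂ => -(2 * w)) (-2) w := by
    simpa using ((hasDerivAt_id w).const_mul (2 : ℂ)).fun_neg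
  exact ((h.cexp.const_mul a).const_sub 1).congr_deriv (by simp only [nvY]; ring)

lemma hasDerivAt_exp_mul (c w : ℂ) :
    HasDerivAt (fun w : ℂ => Complex.exp (c * w)) (c * Complex.exp (c * w)) w := by
  have := ((hasDerivAt_id w).const_mul c).cexp
  simpa [mul_comm] using this

lemma hasDerivAt_nvPhi (u w : ℂ) : HasDerivAt (nvPhi u) (nvG u w) w := by
  have h1 := hasDerivAt_exp_mul 3 w
  have h2 := hasDerivAt_exp_mul (-3) w
  have h3 := hasDerivAt_exp_mul 1 w
  have h4 := hasDerivAt_exp_mul (-1) w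
  have := (((h1.sub h2).const_mul 2).add (h3.const_mul (conj u))).sub (h4.const_mul u)
  refine (this.congr_of_eventuallyEq (Eventually.of_forall fun w => ?_)).congr_deriv ?_
  · simp [nvPhi]
  · simp only [nvG, neg_mul, one_mul]; ring

lemma IsNVRoots.hasDerivAt_nvG (hz : IsNVRoots u z) {w : ℂ} (hy : ∀ k, nvY (z k) w ≠ 0) :
    HasDerivAt (nvG u) (nvG u w * (-3 + 2 * ∑ k, (nvY (z k) w)⁻¹)) w := by
  have e : nvG u = fun w => 6 * Complex.exp (3 * w) * (nvY (z 0) w * nvY (z 1) w * nvY (z 2) w) := by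
    funext w; rw [hz.eq_prod, Fin.prod_univ_three]
  have := ((hasDerivAt_exp_mul 3 w).const_mul 6).mul
    (((hasDerivAt_nvY (z 0) w).mul (hasDerivAt_nvY (z 1) w)).mul (hasDerivAt_nvY (z 2) w))
  rw [e]
  refine this.congr_deriv ?_
  simp only [Fin.sum_univ_three, Pi.mul_apply]
  have h0 := hy 0
  have h1 := hy 1
  have h2 := hy 2
  field_simp
  ring

lemma IsNVRoots.nvY_ne_zero (hz : IsNVRoots u z) {w : ℂ} (hG : nvG u w ≠ 0) (k : Fin 3) :
    nvY (z k) w ≠ 0 := by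
  rw [hz.eq_prod] at hG
  exact Finset.prod_ne_zero_iff.1 (right_ne_zero_of_mul hG) k (Finset.mem_univ k)

lemma nvTau_pos {σ : ℝ} (h : 0 < σ) : 0 < nvTau σ := by
  rw [nvTau, sub_pos, Real.exp_lt_one_iff]; linarith

lemma nvTau_lt_one (σ : ℝ) : nvTau σ < 1 := by
  have := Real.exp_pos (-(2 * σ)); rw [nvTau]; linarith

lemma inv_nvTau_sq_le_nvP (z : Fin 3 → ℂ) (x : ℝ × ℝ) : (nvTau x.1 ^ 2)⁻¹ ≤ nvP z x :=
  le_add_of_nonneg_right (Finset.sum_nonneg fun _ _ => by positivity)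

lemma inv_nvY_sq_le_nvP (z : Fin 3 → ℂ) (x : ℝ × ℝ) (k : Fin 3) :
    (‖nvY (z k) (cylPoint x)‖ ^ 2)⁻¹ ≤ nvP z x := by
  have : (‖nvY (z k) (cylPoint x)‖ ^ 2)⁻¹ ≤ ∑ k, (‖nvY (z k) (cylPoint x)‖ ^ 2)⁻¹ :=
    Finset.single_le_sum (f := fun k => (‖nvY (z k) (cylPoint x)‖ ^ 2)⁻¹)
      (fun _ _ => by positivity) (Finset.mem_univ k)
  rw [nvP]
  have h2 : 0 ≤ (nvTau x.1 ^ 2)⁻¹ := by positivity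
  linarith

lemma inv_nvTau_le_sqrt : (nvTau x.1)⁻¹ ≤ √(nvP z x) := by
  apply Real.le_sqrt_of_sq_le
  rw [inv_pow]; exact inv_nvTau_sq_le_nvP z x

lemma inv_nvY_le_sqrt (k : Fin 3) : ‖nvY (z k) (cylPoint x)‖⁻¹ ≤ √(nvP z x) := by
  apply Real.le_sqrt_of_sq_le
  rw [inv_pow]; exact inv_nvY_sq_le_nvP z x k

lemma one_le_sqrt_nvP (hx : 0 < x.1) : 1 ≤ √(nvP z x) :=
  (one_le_inv_iff₀.2 ⟨nvTau_pos hx, (nvTau_lt_one _).le⟩).trans (inv_nvTau_le_sqrt)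

lemma nvP_pos (hx : 0 < x.1) : 0 < nvP z x := by
  have := nvTau_pos hx
  exact lt_of_lt_of_le (by positivity) (inv_nvTau_sq_le_nvP z x)

/-- The logarithmic derivative of `nvG`. -/
lemma norm_logDeriv_le (hx : 0 < x.1) :
    ‖(-3 : ℂ) + 2 * ∑ k, (nvY (z k) (cylPoint x))⁻¹‖ ≤ 9 * √(nvP z x) := by
  have h1 : ‖∑ k, (nvY (z k) (cylPoint x))⁻¹‖ ≤ ∑ _k : Fin 3, √(nvP z x) :=
    norm_sum_le_of_le _ fun k _ => by rw [norm_inv]; exact inv_nvY_le_sqrt k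
  have h2 := one_le_sqrt_nvP (z := z) hx
  simp at h1
  calc _ ≤ ‖(-3 : ℂ)‖ + ‖2 * ∑ k, (nvY (z k) (cylPoint x))⁻¹‖ := norm_add_le _ _
    _ ≤ 3 + 2 * (3 * √(nvP z x)) := by
        rw [norm_mul]; simp; linarith
    _ ≤ _ := by linarith

/-- An inverse square loses one more power of the distance when differentiated, since `‖Y'‖ ≤ 2(1 +
‖Y‖)`; lower powers are absorbed by `1 ≤ √P`. The constant is `4` from `τ` plus `8` from each of the
three roots. -/
lemma exists_hasDbarAt_nvP (hx : 0 < x.1) (hy : ∀ k, nvY (z k) (cylPoint x) ≠ 0) :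
    ∃ d, HasDbarAt (fun x => (nvP z x : ℂ)) d x ∧ ‖d‖ ≤ 28 * √(nvP z x) ^ 3 := by
  set p := √(nvP z x)
  have hτ := nvTau_pos hx
  have h1p : 1 ≤ p := one_le_sqrt_nvP hx
  have e : (fun x => (nvP z x : ℂ)) = fun x => ((nvTau x.1 : ℂ) * (nvTau x.1 : ℂ))⁻¹ +
      ∑ k, (nvY (z k) (cylPoint x) * conj (nvY (z k) (cylPoint x)))⁻¹ := by
    funext x
    simp [nvP, Complex.mul_conj, Complex.normSq_eq_norm_sq, pow_two]
  have ht : HasDbarAt (fun x => (nvTau x.1 : ℂ)) (2 * Real.exp (-(2 * x.1)) : ℝ) x := by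
    refine hasDbarAt_fst (a := fun s => (nvTau s : ℂ)) (HasDerivAt.ofReal_comp ?_)
    have h : HasDerivAt (fun w : ℝ => -(2 * w)) (-2) x.1 := by
      simpa using ((hasDerivAt_id x.1).const_mul (2 : ℝ)).fun_neg
    exact (h.exp.const_sub 1).congr_deriv (by ring)
  have ht0 : (nvTau x.1 : ℂ) ≠ 0 := by exact_mod_cast hτ.ne'
  have hcy : ∀ k, conj (nvY (z k) (cylPoint x)) ≠ 0 := fun k => by simpa using hy k
  have hY : ∀ k ∈ Finset.univ, HasDbarAt
      (fun x => (nvY (z k) (cylPoint x) * conj (nvY (z k) (cylPoint x)))⁻¹) _ x := fun k _ =>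
    ((hasDbarAt_holo (hasDerivAt_nvY (z k) (cylPoint x))).mul
      (hasDbarAt_conj_holo (hasDerivAt_nvY (z k) (cylPoint x)))).inv (mul_ne_zero (hy k) (hcy k))
  have H := ((ht.mul ht).inv (mul_ne_zero ht0 ht0)).add (HasDbarAt.sum hY)
  rw [e]
  refine ⟨_, H, ?_⟩
  have b1 : ∀ k, ‖-(0 * conj (nvY (z k) (cylPoint x)) + nvY (z k) (cylPoint x) *
      (2 * conj (2 * (1 - nvY (z k) (cylPoint x))))) /
        (nvY (z k) (cylPoint x) * conj (nvY (z k) (cylPoint x))) ^ 2‖ ≤ 8 * p ^ 3 := by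
    intro k
    have hip : ‖nvY (z k) (cylPoint x)‖⁻¹ ≤ p := inv_nvY_le_sqrt k
    set y := nvY (z k) (cylPoint x)
    have hn : 0 < ‖y‖ := norm_pos_iff.2 (hy k)
    have h1 : ‖(1 : ℂ) - y‖ ≤ 1 + ‖y‖ := by simpa using norm_sub_le (1 : ℂ) y
    have : ‖-(0 * conj y + y * (2 * conj (2 * (1 - y)))) / (y * conj y) ^ 2‖ =
        4 * ‖1 - y‖ * ‖y‖⁻¹ ^ 3 := by
      rw [norm_div, norm_neg, zero_mul, zero_add]
      simp only [norm_mul, norm_pow, RCLike.norm_conj, Complex.norm_ofNat]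
      field_simp
      ring
    rw [this]
    calc 4 * ‖1 - y‖ * ‖y‖⁻¹ ^ 3 ≤ 4 * (1 + ‖y‖) * ‖y‖⁻¹ ^ 3 := by gcongr
      _ = 4 * ‖y‖⁻¹ ^ 3 + 4 * ‖y‖⁻¹ ^ 2 := by field_simp
      _ ≤ 4 * p ^ 3 + 4 * p ^ 2 := by gcongr
      _ ≤ 4 * p ^ 3 + 4 * p ^ 3 := by (gcongr; norm_num)
      _ = 8 * p ^ 3 := by ring
  have b2 : ‖-(((2 * Real.exp (-(2 * x.1)) : ℝ) : ℂ) * (nvTau x.1 : ℂ) + (nvTau x.1 : ℂ) *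
      ((2 * Real.exp (-(2 * x.1)) : ℝ) : ℂ)) / ((nvTau x.1 : ℂ) * (nvTau x.1 : ℂ)) ^ 2‖ ≤
        4 * p ^ 3 := by
    have hip : (nvTau x.1)⁻¹ ≤ p := inv_nvTau_le_sqrt
    have h1 : Real.exp (-(2 * x.1)) ≤ 1 := by rw [Real.exp_le_one_iff]; linarith
    have : -(((2 * Real.exp (-(2 * x.1)) : ℝ) : ℂ) * (nvTau x.1 : ℂ) + (nvTau x.1 : ℂ) *
      ((2 * Real.exp (-(2 * x.1)) : ℝ) : ℂ)) / ((nvTau x.1 : ℂ) * (nvTau x.1 : ℂ)) ^ 2 =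
      ((-(4 * Real.exp (-(2 * x.1)) * (nvTau x.1)⁻¹ ^ 3) : ℝ) : ℂ) := by
      push_cast; field_simp; ring
    rw [this, Complex.norm_real, norm_neg, Real.norm_of_nonneg (by positivity)]
    calc _ ≤ 4 * 1 * p ^ 3 := by gcongr
      _ = _ := by ring
  refine (norm_add_le _ _).trans ?_
  refine (add_le_add b2 (norm_sum_le_of_le _ fun k _ => b1 k)).trans ?_
  simp
  linarith [pow_nonneg (Real.sqrt_nonneg (nvP z x)) 3]

end pointwise

/-! ### Logarithmic derivative of the amplitude. -/

section amplitude

variable {α β σ : ℝ}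

lemma norm_nvAmp (hσ : 0 < σ) :
    ‖nvAmp α β σ‖ = (2 * Real.sinh σ) ^ α * (2 * Real.sinh (2 * σ)) := by
  have h1 : 0 < 2 * Real.sinh σ := by have := Real.sinh_pos_iff.2 hσ; positivity
  have h2 : 0 < 2 * Real.sinh (2 * σ) := by
    have := Real.sinh_pos_iff.2 (show 0 < 2 * σ by positivity); positivity
  rw [nvAmp, norm_mul, Complex.norm_cpow_eq_rpow_re_of_pos h1, Complex.norm_real,
    Real.norm_of_nonneg h2.le]
  simp

lemma cosh_div_sinh_le (hσ : 0 < σ) : Real.cosh σ / Real.sinh σ ≤ 2 * (nvTau σ)⁻¹ := by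
  have hs := Real.sinh_pos_iff.2 hσ
  have ht := nvTau_pos hσ
  rw [← div_eq_mul_inv, div_le_div_iff₀ hs ht]
  have e : nvTau σ = 2 * Real.exp (-σ) * Real.sinh σ := by
    rw [nvTau, Real.sinh_eq, show -(2 * σ) = -σ + -σ by ring, Real.exp_add]
    have : Real.exp (-σ) * Real.exp σ = 1 := by rw [← Real.exp_add]; simp
    linear_combination -this
  have h : Real.cosh σ * Real.exp (-σ) ≤ 1 := by
    have h1 : Real.exp (-σ) * Real.exp σ = 1 := by rw [← Real.exp_add]; simp
    have h2 : Real.exp (-σ) ≤ 1 := by rw [Real.exp_le_one_iff]; linarith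
    rw [Real.cosh_eq]
    nlinarith [Real.exp_pos (-σ)]
  rw [e]
  nlinarith

lemma cosh_two_div_sinh_two_le (hσ : 0 < σ) :
    Real.cosh (2 * σ) / Real.sinh (2 * σ) ≤ Real.cosh σ / Real.sinh σ := by
  have hs := Real.sinh_pos_iff.2 hσ
  have hc := Real.cosh_pos σ
  have hs2 := Real.sinh_pos_iff.2 (show 0 < 2 * σ by positivity)
  rw [div_le_div_iff₀ hs2 hs, Real.cosh_two_mul, Real.sinh_two_mul]
  have := Real.cosh_sq σ
  nlinarith

/-- The logarithmic derivative is `(α + iβ) coth σ + 2 coth 2σ`, and both hyperbolic cotangents are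
at most `2 / τ`. This is the only source of the factor `1 + |β|`. -/
lemma exists_hasDerivAt_nvAmp (hα₀ : 0 ≤ α) (hα₁ : α ≤ 1) (hσ : 0 < σ) :
    ∃ a', HasDerivAt (nvAmp α β) a' σ ∧
      ‖a'‖ ≤ 6 * (1 + |β|) * (nvTau σ)⁻¹ * ‖nvAmp α β σ‖ := by
  have hs := Real.sinh_pos_iff.2 hσ
  have hs2 := Real.sinh_pos_iff.2 (show 0 < 2 * σ by positivity)
  have hc := Real.cosh_pos σ
  have hc2 := Real.cosh_pos (2 * σ)
  set c : ℂ := (α : ℂ) + Complex.I * (β : ℂ)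
  have d1 : HasDerivAt (fun s : ℝ => ((2 * Real.sinh s : ℝ) : ℂ)) ((2 * Real.cosh σ : ℝ) : ℂ) σ :=
    ((Real.hasDerivAt_sinh σ).const_mul 2).ofReal_comp
  have d2 : HasDerivAt (fun s : ℝ => ((2 * Real.sinh (2 * s) : ℝ) : ℂ))
      ((4 * Real.cosh (2 * σ) : ℝ) : ℂ) σ := by
    refine HasDerivAt.ofReal_comp ?_
    have : HasDerivAt (fun s : ℝ => 2 * s) 2 σ := by
      simpa using (hasDerivAt_id σ).const_mul (2 : ℝ)
    exact (this.sinh.const_mul 2).congr_deriv (by ring)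
  have hm : ((2 * Real.sinh σ : ℝ) : ℂ) ∈ Complex.slitPlane := by
    rw [Complex.ofReal_mem_slitPlane]; positivity
  have d3 := (Complex.hasStrictDerivAt_cpow_const (c := c) hm).hasDerivAt.comp σ d1
  have d4 := d3.mul d2
  have hb : ((2 * Real.sinh σ : ℝ) : ℂ) ≠ 0 := by exact_mod_cast (by positivity)
  refine ⟨nvAmp α β σ * (c * ((Real.cosh σ / Real.sinh σ : ℝ) : ℂ) +
    ((2 * (Real.cosh (2 * σ) / Real.sinh (2 * σ)) : ℝ) : ℂ)), ?_, ?_⟩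
  · refine d4.congr_deriv ?_
    have hs' : (Real.sinh σ : ℂ) ≠ 0 := by exact_mod_cast hs.ne'
    have hs2' : (Real.sinh (2 * σ) : ℂ) ≠ 0 := by exact_mod_cast hs2.ne'
    rw [Complex.cpow_sub _ _ hb]
    simp only [nvAmp, Function.comp_apply, Complex.cpow_one, Complex.ofReal_mul,
      Complex.ofReal_div, Complex.ofReal_ofNat]
    field_simp
    ring
  · rw [norm_mul, mul_comm]
    gcongr
    have k1 := cosh_div_sinh_le hσ
    have k2 := cosh_two_div_sinh_two_le hσ
    have hcn : ‖c‖ ≤ 1 + |β| := by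
      refine (norm_add_le _ _).trans ?_
      rw [norm_mul, Complex.norm_real, Complex.norm_real, Complex.norm_I, one_mul,
        Real.norm_of_nonneg hα₀, Real.norm_eq_abs]
      linarith
    have ht : 0 < (nvTau σ)⁻¹ := inv_pos.2 (nvTau_pos hσ)
    calc _ ≤ ‖c‖ * (Real.cosh σ / Real.sinh σ) + 2 * (Real.cosh (2 * σ) / Real.sinh (2 * σ)) := by
          refine (norm_add_le _ _).trans ?_
          rw [norm_mul, Complex.norm_real, Complex.norm_real, Real.norm_of_nonneg (by positivity),
            Real.norm_of_nonneg (by positivity)]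
      _ ≤ (1 + |β|) * (2 * (nvTau σ)⁻¹) + 2 * (2 * (nvTau σ)⁻¹) := by
          gcongr
          exact k2.trans k1
      _ ≤ _ := by nlinarith [abs_nonneg β, mul_nonneg (abs_nonneg β) ht.le]

end amplitude

/-! ### The regularized multiplier and the pointwise remainder. -/

/-- The phase factor `e^{itS}`. -/
noncomputable def nvOsc (t : ℝ) (u : ℂ) (x : ℝ × ℝ) : ℂ :=
  Complex.exp (Complex.I * t * ((nvPhi u (cylPoint x)).re : ℂ))

/-- The inverse of the multiplier used to integrate by parts. -/
noncomputable def nvM (t : ℝ) (u : ℂ) (z : Fin 3 → ℂ) (x : ℝ × ℝ) : ℂ :=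
  conj (nvG u (cylPoint x)) + (nvP z x : ℂ) * ((t ^ 2 : ℝ) : ℂ)⁻¹ * (nvG u (cylPoint x))⁻¹

/-- The function whose `dbar` is the main part of the integrand. -/
noncomputable def nvF (α β t : ℝ) (u : ℂ) (z : Fin 3 → ℂ) (x : ℝ × ℝ) : ℂ :=
  nvAmp α β x.1 * (nvM t u z x)⁻¹ * nvOsc t u x

section pointwise

variable {u : ℂ} {z : Fin 3 → ℂ} {x : ℝ × ℝ} {α β t : ℝ}

lemma norm_nvOsc (t : ℝ) (u : ℂ) (x : ℝ × ℝ) : ‖nvOsc t u x‖ = 1 := by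
  rw [nvOsc, Complex.norm_exp]
  simp

/-- Writing `Re Φ = (Φ + conj Φ) / 2`, only the antiholomorphic half is seen by `dbar`. -/
lemma hasDbarAt_nvOsc (t : ℝ) (u : ℂ) (x : ℝ × ℝ) :
    HasDbarAt (nvOsc t u) (nvOsc t u x * (Complex.I * t * conj (nvG u (cylPoint x)))) x := by
  have h := hasDerivAt_nvPhi u (cylPoint x)
  have h1 := (HasDbarAt.const (x := x) (Complex.I * t / 2)).mul
    ((hasDbarAt_holo h).add (hasDbarAt_conj_holo h))
  have h2 := h1.holo_comp (Complex.hasDerivAt_exp _)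
  have e : nvOsc t u = fun x => Complex.exp (Complex.I * t / 2 *
      (nvPhi u (cylPoint x) + conj (nvPhi u (cylPoint x)))) := by
    funext x
    rw [nvOsc, Complex.add_conj]
    congr 1
    push_cast
    ring
  rw [e]
  exact h2.congr_value (by ring)

/-- The product `M g = |g|² + P / t²` is real and positive, so there is no cancellation between the
two terms of `M`. -/
lemma norm_nvM (hx : 0 < x.1) (hG : nvG u (cylPoint x) ≠ 0) :
    ‖nvM t u z x‖ = ‖nvG u (cylPoint x)‖ *
      (1 + (√(nvP z x) / (t * ‖nvG u (cylPoint x)‖)) ^ 2) := by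
  have hP := nvP_pos (z := z) hx
  have hg : 0 < ‖nvG u (cylPoint x)‖ := norm_pos_iff.2 hG
  have e : nvM t u z x * nvG u (cylPoint x) =
      ((‖nvG u (cylPoint x)‖ ^ 2 + nvP z x * (t ^ 2)⁻¹ : ℝ) : ℂ) := by
    rw [nvM, add_mul, mul_comm (conj _), Complex.mul_conj, Complex.normSq_eq_norm_sq, mul_assoc,
      inv_mul_cancel₀ hG]
    push_cast; ring
  have := congrArg norm e
  rw [norm_mul, Complex.norm_real, Real.norm_of_nonneg (by positivity)] at this
  rw [← mul_left_inj' hg.ne', this, div_pow, Real.sq_sqrt hP.le]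
  field_simp

/-- Differentiating `ḡ` costs `2 · 9 √P`, while `1 / g` is holomorphic and contributes nothing, so
in the second term only `P` is differentiated. Both results are then compared with the two terms of
`‖M‖`. -/
lemma exists_hasDbarAt_nvM (hz : IsNVRoots u z) (hx : 0 < x.1) (ht : 0 < t)
    (hG : nvG u (cylPoint x) ≠ 0) :
    ∃ d, HasDbarAt (nvM t u z) d x ∧ ‖d‖ ≤ 28 * √(nvP z x) * ‖nvM t u z x‖ := by
  obtain ⟨d, hd, hdn⟩ := exists_hasDbarAt_nvP hx (hz.nvY_ne_zero hG)
  have hG' := hz.hasDerivAt_nvG (hz.nvY_ne_zero hG)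
  have H := (hasDbarAt_conj_holo hG').add
    ((hd.mul (.const ((t ^ 2 : ℝ) : ℂ)⁻¹)).mul ((hasDbarAt_holo hG').inv hG))
  refine ⟨_, H, ?_⟩
  rw [norm_nvM hx hG]
  set p := √(nvP z x)
  set g := ‖nvG u (cylPoint x)‖
  have hp : 1 ≤ p := one_le_sqrt_nvP hx
  have hg : 0 < g := norm_pos_iff.2 hG
  have b1 : ‖2 * conj (nvG u (cylPoint x) *
      (-3 + 2 * ∑ k, (nvY (z k) (cylPoint x))⁻¹))‖ ≤ 2 * (g * (9 * p)) := by
    rw [norm_mul, RCLike.norm_conj, norm_mul, Complex.norm_ofNat]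
    gcongr
    exact norm_logDeriv_le hx
  refine (norm_add_le _ _).trans ((add_le_add_left b1 _).trans ?_)
  simp only [mul_zero, add_zero, neg_zero, zero_div, norm_mul, norm_inv, Complex.norm_real,
    Real.norm_of_nonneg (sq_nonneg t)]
  calc 2 * (g * (9 * p)) + ‖d‖ * (t ^ 2)⁻¹ * g⁻¹
      ≤ 2 * (g * (9 * p)) + 28 * p ^ 3 * (t ^ 2)⁻¹ * g⁻¹ := by gcongr
    _ ≤ 28 * (g * p) + 28 * p ^ 3 * (t ^ 2)⁻¹ * g⁻¹ := by
        have : 0 < g * p := by positivity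
        linarith
    _ = _ := by field_simp

/-- Interpolation: the left side is `O(q)` for small `q` and bounded for large `q`, hence is
controlled by any power between `0` and `1`. -/
lemma sq_add_mul_div_le {q κ b : ℝ} (hq : 0 < q) (hκ₀ : 0 ≤ κ) (hκ₁ : κ ≤ 1) (hb : 0 ≤ b) :
    (q ^ 2 + b * q) / (1 + q ^ 2) ≤ (1 + b) * q ^ κ := by
  rw [div_le_iff₀ (by positivity)]
  rcases le_total q 1 with h | h
  · have h1 : q ≤ q ^ κ := by
      simpa using Real.rpow_le_rpow_of_exponent_ge hq h hκ₁
    have h2 : 0 < q ^ κ := by positivity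
    have h3 : q ^ 2 ≤ q ^ κ := by nlinarith
    calc q ^ 2 + b * q ≤ q ^ κ + b * q ^ κ := by gcongr
      _ = (1 + b) * q ^ κ * 1 := by ring
      _ ≤ _ := by gcongr; nlinarith
  · have h1 : 1 ≤ q ^ κ := Real.one_le_rpow h hκ₀
    calc q ^ 2 + b * q ≤ (1 + b) * 1 * (1 + q ^ 2) := by
          nlinarith [mul_nonneg hb (show 0 ≤ 1 + q ^ 2 - q by nlinarith)]
      _ ≤ _ := by gcongr

/-- Three errors remain: replacing `ḡ` by `M`, of relative size `q² / (1 + q²)`, and the derivatives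
of `A` and of `1 / M`, each of relative size `O(q / (1 + q²))`. The constant is `35 = 1 + 6 + 28`.
-/
lemma differentiableAt_nvF_and_norm_sub_le (hz : IsNVRoots u z) (hx : 0 < x.1) (ht : 0 < t)
    (hG : nvG u (cylPoint x) ≠ 0) (hα₀ : 0 ≤ α) (hα₁ : α ≤ 1) {κ : ℝ} (hκ₀ : 0 ≤ κ)
    (hκ₁ : κ ≤ 1) :
    DifferentiableAt ℝ (nvF α β t u z) x ∧
      ‖nvAmp α β x.1 * nvOsc t u x - (Complex.I * t)⁻¹ * dbar (nvF α β t u z) x‖ ≤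
        35 * (1 + |β|) * (‖nvAmp α β x.1‖ *
          (√(nvP z x) / (t * ‖nvG u (cylPoint x)‖)) ^ κ) := by
  obtain ⟨d, hd, hdn⟩ := exists_hasDbarAt_nvM (t := t) hz hx ht hG
  obtain ⟨a, ha, han⟩ := exists_hasDerivAt_nvAmp (β := β) hα₀ hα₁ hx
  have hP := nvP_pos (z := z) hx
  have hg : 0 < ‖nvG u (cylPoint x)‖ := norm_pos_iff.2 hG
  have hMn := norm_nvM (t := t) (z := z) hx hG
  have hM0 : nvM t u z x ≠ 0 := by
    rw [← norm_pos_iff, hMn]; positivity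
  have H := ((hasDbarAt_fst ha).mul (hd.inv hM0)).mul (hasDbarAt_nvOsc t u x)
  refine ⟨H.1, ?_⟩
  rw [show dbar (nvF α β t u z) x = _ from H.2]
  have hp : (nvTau x.1)⁻¹ ≤ √(nvP z x) := inv_nvTau_le_sqrt
  have hp1 : 1 ≤ √(nvP z x) := one_le_sqrt_nvP hx
  set p := √(nvP z x)
  set g := ‖nvG u (cylPoint x)‖
  set q := p / (t * g)
  have hq : 0 < q := by positivity
  have htc : (t : ℂ) ≠ 0 := by exact_mod_cast ht.ne'
  have eM : nvM t u z x - conj (nvG u (cylPoint x)) =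
      (nvP z x : ℂ) * ((t ^ 2 : ℝ) : ℂ)⁻¹ * (nvG u (cylPoint x))⁻¹ := by
    rw [nvM]; ring
  have eq : nvAmp α β x.1 * nvOsc t u x - (Complex.I * t)⁻¹ *
      ((a * (nvM t u z x)⁻¹ + nvAmp α β x.1 * (-d / nvM t u z x ^ 2)) * nvOsc t u x +
      nvAmp α β x.1 * (nvM t u z x)⁻¹ *
        (nvOsc t u x * (Complex.I * t * conj (nvG u (cylPoint x))))) =
      nvOsc t u x * (nvAmp α β x.1 * ((nvM t u z x - conj (nvG u (cylPoint x))) *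
        (nvM t u z x)⁻¹) - (Complex.I * t)⁻¹ * (a * (nvM t u z x)⁻¹) +
        (Complex.I * t)⁻¹ * (nvAmp α β x.1 * (d * (nvM t u z x)⁻¹ ^ 2))) := by
    have hI := Complex.I_ne_zero
    field_simp
    ring
  rw [eq, norm_mul, norm_nvOsc, one_mul, eM]
  set A := ‖nvAmp α β x.1‖
  have hA : 0 ≤ A := norm_nonneg _
  have nI : ‖(Complex.I * t)⁻¹‖ = t⁻¹ := by
    rw [norm_inv, norm_mul, Complex.norm_I, one_mul, Complex.norm_real,
      Real.norm_of_nonneg ht.le]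
  have n1 : ‖nvAmp α β x.1 * ((nvP z x : ℂ) * ((t ^ 2 : ℝ) : ℂ)⁻¹ * (nvG u (cylPoint x))⁻¹ *
      (nvM t u z x)⁻¹)‖ = A * (q ^ 2 / (1 + q ^ 2)) := by
    rw [norm_mul, norm_mul, norm_mul, norm_mul, norm_inv, norm_inv, norm_inv, hMn,
      Complex.norm_real, Complex.norm_real, Real.norm_of_nonneg (sq_nonneg t),
      Real.norm_of_nonneg hP.le, ← Real.sq_sqrt hP.le]
    change A * (p ^ 2 * (t ^ 2)⁻¹ * g⁻¹ * (g * (1 + q ^ 2))⁻¹) = _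
    simp only [q]
    field_simp
  have n2 : ‖(Complex.I * t)⁻¹ * (a * (nvM t u z x)⁻¹)‖ ≤
      A * (6 * (1 + |β|) * q / (1 + q ^ 2)) := by
    rw [norm_mul, norm_mul, norm_inv (nvM t u z x), hMn, nI]
    calc t⁻¹ * (‖a‖ * (g * (1 + q ^ 2))⁻¹)
        ≤ t⁻¹ * (6 * (1 + |β|) * p * A * (g * (1 + q ^ 2))⁻¹) := by
          gcongr
          exact han.trans (by gcongr)
      _ = _ := by
          have : p = q * (t * g) := by simp only [q]; field_simp
          rw [this]; field_simp
  have n3 : ‖(Complex.I * t)⁻¹ * (nvAmp α β x.1 * (d * (nvM t u z x)⁻¹ ^ 2))‖ ≤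
      A * (28 * q / (1 + q ^ 2)) := by
    rw [norm_mul, norm_mul, norm_mul, norm_pow, norm_inv (nvM t u z x), nI]
    calc t⁻¹ * (A * (‖d‖ * ‖nvM t u z x‖⁻¹ ^ 2))
        ≤ t⁻¹ * (A * (28 * p * ‖nvM t u z x‖ * ‖nvM t u z x‖⁻¹ ^ 2)) := by gcongr
      _ = t⁻¹ * (A * (28 * p * ‖nvM t u z x‖⁻¹)) := by
          have : ‖nvM t u z x‖ ≠ 0 := norm_ne_zero_iff.2 hM0
          field_simp
      _ = _ := by
          have : p = q * (t * g) := by simp only [q]; field_simp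
          rw [hMn, this]
          change t⁻¹ * (A * (28 * (q * (t * g)) * (g * (1 + q ^ 2))⁻¹)) = _
          field_simp
  refine (norm_add_le _ _).trans ((add_le_add (norm_sub_le _ _) n3).trans ?_)
  refine (add_le_add_left (add_le_add n1.le n2) _).trans ?_
  have hb : 0 ≤ 6 * (1 + |β|) + 28 := by positivity
  calc A * (q ^ 2 / (1 + q ^ 2)) + A * (6 * (1 + |β|) * q / (1 + q ^ 2)) +
        A * (28 * q / (1 + q ^ 2))
      = A * ((q ^ 2 + (6 * (1 + |β|) + 28) * q) / (1 + q ^ 2)) := by ring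
    _ ≤ A * ((1 + (6 * (1 + |β|) + 28)) * q ^ κ) := by
        gcongr; exact sq_add_mul_div_le hq hκ₀ hκ₁ hb
    _ ≤ A * ((35 * (1 + |β|)) * q ^ κ) := by
        gcongr; nlinarith [abs_nonneg β]
    _ = _ := by ring

/-- The size of `nvF`, valid also at the zeros of `nvG`. -/
lemma norm_nvF_le (hx : 0 < x.1) (ht : 0 < t) :
    ‖nvF α β t u z x‖ ≤ t ^ 2 * (‖nvAmp α β x.1‖ * ‖nvG u (cylPoint x)‖) := by
  rw [nvF, norm_mul, norm_mul, norm_nvOsc, mul_one]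
  -- At a zero of `g` the convention `0⁻¹ = 0` makes `M`, then `M⁻¹` and `nvF`, equal to zero, which
  -- is also the limiting value.
  by_cases hG : nvG u (cylPoint x) = 0
  · simp [nvM, hG]
  have hg : 0 < ‖nvG u (cylPoint x)‖ := norm_pos_iff.2 hG
  have hp1 : 1 ≤ √(nvP z x) := one_le_sqrt_nvP hx
  have : ‖(nvM t u z x)⁻¹‖ ≤ t ^ 2 * ‖nvG u (cylPoint x)‖ := by
    rw [norm_inv, norm_nvM hx hG, inv_le_iff_one_le_mul₀ (by positivity)]
    set g := ‖nvG u (cylPoint x)‖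
    set p := √(nvP z x)
    calc (1 : ℝ) ≤ p ^ 2 := one_le_pow₀ hp1
      _ ≤ t ^ 2 * g ^ 2 + p ^ 2 := le_add_of_nonneg_left (by positivity)
      _ = _ := by field_simp
  calc _ ≤ ‖nvAmp α β x.1‖ * (t ^ 2 * ‖nvG u (cylPoint x)‖) := by gcongr
    _ = _ := by ring

lemma norm_nvF_le_div (hx : 0 < x.1) :
    ‖nvF α β t u z x‖ ≤ ‖nvAmp α β x.1‖ * ‖nvG u (cylPoint x)‖⁻¹ := by
  rw [nvF, norm_mul, norm_mul, norm_nvOsc, mul_one]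
  by_cases hG : nvG u (cylPoint x) = 0
  · simp [nvM, hG]
  have hg : 0 < ‖nvG u (cylPoint x)‖ := norm_pos_iff.2 hG
  gcongr
  rw [norm_inv, norm_nvM hx hG]
  gcongr
  exact le_mul_of_one_le_right hg.le (by nlinarith [sq_nonneg (√(nvP z x) /
    (t * ‖nvG u (cylPoint x)‖))])

end pointwise

/-! ### Integrability of the singular kernels, uniformly in the root. -/

lemma intervalIntegrable_abs_rpow {q : ℝ} (hq : q < 1) (a b : ℝ) :
    IntervalIntegrable (fun x : ℝ => |x| ^ (-q)) volume a b := by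
  have key : ∀ c : ℝ, 0 ≤ c → IntervalIntegrable (fun x : ℝ => |x| ^ (-q)) volume 0 c := by
    intro c hc
    refine (intervalIntegral.intervalIntegrable_rpow' (show -1 < -q by linarith)).congr ?_
    intro x hx
    rw [Set.uIoc_of_le hc] at hx
    simp [abs_of_pos hx.1]
  have key2 : ∀ c : ℝ, IntervalIntegrable (fun x : ℝ => |x| ^ (-q)) volume 0 c := by
    intro c
    rcases le_total 0 c with h | h
    · exact key c h
    · rw [IntervalIntegrable.iff_comp_neg]
      simpa using key (-c) (by linarith)
  exact (key2 a).symm.trans (key2 b)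

lemma intervalIntegrable_abs_sin_rpow {q : ℝ} (hq₀ : 0 ≤ q) (hq : q < 1) (a b : ℝ) :
    IntervalIntegrable (fun x : ℝ => |Real.sin x| ^ (-q)) volume a b := by
  have hper : Function.Periodic (fun x : ℝ => |Real.sin x| ^ (-q)) Real.pi := fun x => by
    simp [Real.sin_add_pi]
  refine hper.intervalIntegrable (t := -(Real.pi / 2)) Real.pi_pos.ne' ?_ a b
  have hpi := Real.pi_pos
  have h1 := (intervalIntegrable_abs_rpow hq (-(Real.pi / 2)) (-(Real.pi / 2) + Real.pi)).const_mul
    ((2 / Real.pi) ^ (-q))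
  refine h1.mono_fun (Measurable.aestronglyMeasurable (by fun_prop)) ?_
  rw [Set.uIoc_of_le (by linarith)]
  filter_upwards [ae_restrict_mem measurableSet_Ioc, ae_restrict_of_ae (Measure.ae_ne volume (0 : ℝ))] with x hx hx0
  have hx' : |x| ≤ Real.pi / 2 := abs_le.2 ⟨hx.1.le, by linarith [hx.2]⟩
  have hpos : 0 < |x| := abs_pos.2 hx0
  rw [Real.norm_of_nonneg (by positivity), Real.norm_of_nonneg (by positivity),
    ← Real.mul_rpow (by positivity) (by positivity)]
  exact Real.rpow_le_rpow_of_nonpos (by positivity) (Real.mul_abs_le_abs_sin hx') (by linarith)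

lemma abs_div_le_abs_one_sub_exp (x : ℝ) : |x| / (1 + |x|) ≤ |1 - Real.exp x| := by
  rcases le_total 0 x with h | h
  · have := Real.add_one_le_exp x
    rw [abs_of_nonneg h, abs_of_nonpos (by linarith), div_le_iff₀ (by linarith)]
    nlinarith
  · have h1 := Real.add_one_le_exp (-x)
    have h2 : Real.exp (-x) * Real.exp x = 1 := by rw [← Real.exp_add]; simp
    have h3 := Real.exp_pos x
    rw [abs_of_nonpos h, abs_of_nonneg (by rw [sub_nonneg, Real.exp_le_one_iff]; exact h),
      div_le_iff₀ (by linarith)]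
    nlinarith

lemma abs_one_sub_exp_rpow_le {q y : ℝ} (hq₀ : 0 ≤ q) (hq : q ≤ 1) (hy : y ≠ 0) :
    |1 - Real.exp (-(2 * y))| ^ (-q) ≤
      2 * (1 + (Set.Icc (-1) 1).indicator (fun y => |y| ^ (-q)) y) := by
  have h := abs_div_le_abs_one_sub_exp (-(2 * y))
  have e : |-(2 * y)| = 2 * |y| := by rw [abs_neg, abs_mul]; simp
  rw [e] at h
  have hpos : 0 < |y| := abs_pos.2 hy
  have h2 : (2⁻¹ : ℝ) ^ (-q) ≤ 2 := by
    rw [Real.rpow_neg (by norm_num), Real.inv_rpow (by norm_num), inv_inv]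
    simpa using Real.rpow_le_rpow_of_exponent_le (show (1 : ℝ) ≤ 2 by norm_num) hq
  by_cases h1 : |y| ≤ 1
  · rw [Set.indicator_of_mem (Set.mem_Icc.2 (abs_le.1 h1))]
    have : 2⁻¹ * |y| ≤ |1 - Real.exp (-(2 * y))| := by
      refine le_trans ?_ h
      rw [le_div_iff₀ (by positivity)]
      nlinarith
    calc _ ≤ (2⁻¹ * |y|) ^ (-q) := Real.rpow_le_rpow_of_nonpos (by positivity) this (by linarith)
      _ = 2⁻¹ ^ (-q) * |y| ^ (-q) := Real.mul_rpow (by norm_num) (by positivity)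
      _ ≤ 2 * (1 + |y| ^ (-q)) := by
        have : 0 ≤ |y| ^ (-q) := by positivity
        nlinarith
  · rw [Set.indicator_of_notMem (fun hm => h1 (abs_le.2 (Set.mem_Icc.1 hm)))]
    have : 2⁻¹ ≤ |1 - Real.exp (-(2 * y))| := by
      refine le_trans ?_ h
      rw [le_div_iff₀ (by positivity)]
      nlinarith
    calc _ ≤ (2⁻¹ : ℝ) ^ (-q) := Real.rpow_le_rpow_of_nonpos (by norm_num) this (by linarith)
      _ ≤ _ := by linarith

lemma abs_one_sub_le_norm_one_sub_mul_exp {r : ℝ} (hr : 0 ≤ r) (φ : ℝ) :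
    |1 - r| ≤ ‖1 - (r : ℂ) * Complex.exp (φ * Complex.I)‖ := by
  have := abs_norm_sub_norm_le (1 : ℂ) ((r : ℂ) * Complex.exp (φ * Complex.I))
  rwa [norm_mul, Complex.norm_exp_ofReal_mul_I, norm_one, mul_one, Complex.norm_real,
    Real.norm_of_nonneg hr] at this

/-- Rotating by `e^{-iφ}` makes the second term real, so the imaginary part no longer depends on
`r`. -/
lemma abs_sin_le_norm_one_sub_mul_exp (r φ : ℝ) :
    |Real.sin φ| ≤ ‖1 - (r : ℂ) * Complex.exp (φ * Complex.I)‖ := by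
  have e : Complex.exp (((-φ : ℝ) : ℂ) * Complex.I) *
      (1 - (r : ℂ) * Complex.exp (φ * Complex.I)) =
      Complex.exp (((-φ : ℝ) : ℂ) * Complex.I) - r := by
    rw [mul_sub, mul_one, mul_left_comm, ← Complex.exp_add]
    simp
  have h := Complex.abs_im_le_norm (Complex.exp (((-φ : ℝ) : ℂ) * Complex.I) *
      (1 - (r : ℂ) * Complex.exp (φ * Complex.I)))
  rw [norm_mul, Complex.norm_exp_ofReal_mul_I, one_mul] at h
  rw [e, Complex.sub_im, Complex.exp_ofReal_mul_I_im, Complex.ofReal_im, sub_zero, Real.sin_neg,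
    abs_neg] at h
  exact h

/-- The root enters only as a translation in `σ` and `θ`; this is what makes the kernel bounds
uniform in it. -/
lemma nvY_eq_polar {a : ℂ} (ha : a ≠ 0) (x : ℝ × ℝ) :
    nvY a (cylPoint x) = 1 - ((Real.exp (-(2 * (x.1 - Real.log ‖a‖ / 2))) : ℝ) : ℂ) *
      Complex.exp (((-(2 * (x.2 - a.arg / 2)) : ℝ) : ℂ) * Complex.I) := by
  have hn : 0 < ‖a‖ := norm_pos_iff.2 ha
  have e : Real.exp (-(2 * (x.1 - Real.log ‖a‖ / 2))) = ‖a‖ * Real.exp (-(2 * x.1)) := by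
    rw [show -(2 * (x.1 - Real.log ‖a‖ / 2)) = Real.log ‖a‖ + -(2 * x.1) by ring, Real.exp_add,
      Real.exp_log hn]
  rw [e, nvY]
  nth_rewrite 1 [← Complex.norm_mul_exp_arg_mul_I a]
  rw [sub_right_inj]
  push_cast
  rw [mul_assoc, mul_assoc, ← Complex.exp_add, ← Complex.exp_add]
  congr 2
  rw [cylPoint]
  ring

/-- Integrability of a negative power of a linear factor over the half cylinder, uniformly in the
root. -/
lemma exists_kernel_bound {c p : ℝ} (hc : 0 < c) (hp₀ : 0 ≤ p) (hp : p < 2) :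
    ∃ C : ℝ, 0 ≤ C ∧ ∀ a : ℂ, a ≠ 0 → ∃ K : ℝ × ℝ → ℝ,
      IntegrableOn K (Set.Ioi 0 ×ˢ Set.Ioo (-Real.pi) Real.pi) ∧
      ∫ x in Set.Ioi 0 ×ˢ Set.Ioo (-Real.pi) Real.pi, K x ≤ C ∧
      ∀ᵐ x, 0 < x.1 → Real.exp (-(c * x.1)) * ‖nvY a (cylPoint x)‖ ^ (-p) ≤ K x := by
  -- The exponent is split equally between the radial bound `|1 - r|` and the angular bound `|sin|`,
  -- which separates the variables; each one-dimensional singularity is then integrable because `q <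
  -- 1`.
  set q := p / 2
  have hq₀ : 0 ≤ q := by positivity
  have hq : q < 1 := by simp only [q]; linarith
  have hpi := Real.pi_pos
  let h : ℝ → ℝ := (Set.Icc (-1) 1).indicator (fun y => |y| ^ (-q))
  let s : ℝ → ℝ := fun θ => |Real.sin (2 * θ)| ^ (-q)
  have hh0 : ∀ y, 0 ≤ h y := Set.indicator_nonneg fun y _ => by positivity
  have hh : Integrable h := by
    rw [integrable_indicator_iff measurableSet_Icc, integrableOn_Icc_iff_integrableOn_Ioc,
      ← intervalIntegrable_iff_integrableOn_Ioc_of_le (by norm_num)]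
    exact intervalIntegrable_abs_rpow hq _ _
  have hs : ∀ a b, IntervalIntegrable s volume a b := fun a b => by
    have := (intervalIntegrable_abs_sin_rpow hq₀ hq (2 * a) (2 * b)).comp_mul_left (c := 2)
    simpa using this
  have hsper : Function.Periodic s (2 * Real.pi) := fun θ => by
    simp only [s]
    rw [show 2 * (θ + 2 * Real.pi) = 2 * θ + (2 : ℕ) * (2 * Real.pi) by push_cast; ring,
      Real.sin_add_nat_mul_two_pi]
  have hE : IntegrableOn (fun σ : ℝ => Real.exp (-(c * σ))) (Set.Ioi 0) := by
    simpa [neg_mul] using exp_neg_integrableOn_Ioi 0 hc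
  set IE := ∫ σ in Set.Ioi (0 : ℝ), Real.exp (-(c * σ))
  set IH := ∫ σ, h σ
  set IS := ∫ θ in (-Real.pi)..Real.pi, s θ
  have hIS : 0 ≤ IS := intervalIntegral.integral_nonneg (by linarith) fun θ _ => by positivity
  have hIE : 0 ≤ IE := setIntegral_nonneg measurableSet_Ioi fun σ _ => by positivity
  have hIH : 0 ≤ IH := integral_nonneg hh0
  refine ⟨2 * (IE + IH) * IS, by positivity, fun a ha => ?_⟩
  set l := Real.log ‖a‖ / 2
  set b := a.arg / 2
  have hF : IntegrableOn (fun σ => 2 * (Real.exp (-(c * σ)) + h (σ - l))) (Set.Ioi 0) :=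
    (hE.add (hh.comp_sub_right l).integrableOn).const_mul 2
  have hS : IntegrableOn (fun θ => s (θ - b)) (Set.Ioo (-Real.pi) Real.pi) := by
    have := (hs (-Real.pi - b) (Real.pi - b)).comp_sub_right b
    simp only [sub_add_cancel] at this
    exact (this.1).mono_set Set.Ioo_subset_Ioc_self
  refine ⟨fun x => 2 * (Real.exp (-(c * x.1)) + h (x.1 - l)) * s (x.2 - b), ?_, ?_, ?_⟩
  · rw [IntegrableOn, Measure.volume_eq_prod, ← Measure.prod_restrict]
    exact hF.mul_prod hS
  · rw [Measure.volume_eq_prod, ← Measure.prod_restrict,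
      integral_prod_mul (fun σ => 2 * (Real.exp (-(c * σ)) + h (σ - l))) (fun θ => s (θ - b))]
    have e1 : ∫ θ in Set.Ioo (-Real.pi) Real.pi, s (θ - b) = IS := by
      rw [← integral_Ioc_eq_integral_Ioo, ← intervalIntegral.integral_of_le (by linarith),
        intervalIntegral.integral_comp_sub_right]
      -- Periodicity removes the dependence on the argument of the root.
      have := hsper.intervalIntegral_add_eq (-Real.pi - b) (-Real.pi)
      rw [show -Real.pi - b + 2 * Real.pi = Real.pi - b by ring,
        show -Real.pi + 2 * Real.pi = Real.pi by ring] at this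
      exact this
    have e2 : ∫ σ in Set.Ioi (0 : ℝ), 2 * (Real.exp (-(c * σ)) + h (σ - l)) ≤ 2 * (IE + IH) := by
      rw [integral_const_mul, integral_add hE (hh.comp_sub_right l).integrableOn]
      have : ∫ σ in Set.Ioi (0 : ℝ), h (σ - l) ≤ IH := by
        refine (setIntegral_le_integral (hh.comp_sub_right l)
          (Eventually.of_forall fun σ => hh0 _)).trans ?_
        rw [integral_sub_right_eq_self h l]
      linarith
    rw [e1]
    gcongr
  · have z1 : ∀ᵐ x : ℝ × ℝ, x.1 ≠ l := by
      rw [Measure.volume_eq_prod]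
      exact Measure.quasiMeasurePreserving_fst.ae (Measure.ae_ne volume l)
    have z2 : ∀ᵐ x : ℝ × ℝ, Real.sin (2 * (x.2 - b)) ≠ 0 := by
      rw [Measure.volume_eq_prod]
      refine Measure.quasiMeasurePreserving_snd.ae (p := fun y => Real.sin (2 * (y - b)) ≠ 0) ?_
      have : (Set.range fun n : ℤ => n * Real.pi / 2 + b).Countable := Set.countable_range _
      filter_upwards [this.ae_notMem volume] with y hy h0
      obtain ⟨n, hn⟩ := Real.sin_eq_zero_iff.1 h0
      exact hy ⟨n, by simp only; rw [hn]; ring⟩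
    filter_upwards [z1, z2] with x h1 h2 hx
    have k1 : |1 - Real.exp (-(2 * (x.1 - l)))| ≤ ‖nvY a (cylPoint x)‖ := by
      rw [nvY_eq_polar ha]
      exact abs_one_sub_le_norm_one_sub_mul_exp (Real.exp_pos _).le _
    have k2 : |Real.sin (2 * (x.2 - b))| ≤ ‖nvY a (cylPoint x)‖ := by
      rw [nvY_eq_polar ha]
      refine le_trans (le_of_eq ?_) (abs_sin_le_norm_one_sub_mul_exp _ _)
      rw [Real.sin_neg, abs_neg]
    have p2 : 0 < |Real.sin (2 * (x.2 - b))| := abs_pos.2 h2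
    have p1 : 0 < |1 - Real.exp (-(2 * (x.1 - l)))| := by
      rw [abs_pos, sub_ne_zero]
      intro h0
      have := Real.exp_eq_one_iff _ |>.1 h0.symm
      exact h1 (by linarith)
    have k3 := abs_one_sub_exp_rpow_le hq₀ hq.le (sub_ne_zero.2 h1)
    have k4 : ‖nvY a (cylPoint x)‖ ^ (-p) ≤ |1 - Real.exp (-(2 * (x.1 - l)))| ^ (-q) *
        |Real.sin (2 * (x.2 - b))| ^ (-q) := by
      have : 0 < ‖nvY a (cylPoint x)‖ := p1.trans_le k1
      rw [show -p = -q + -q by simp only [q]; ring, Real.rpow_add this]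
      exact mul_le_mul (Real.rpow_le_rpow_of_nonpos p1 k1 (by linarith))
        (Real.rpow_le_rpow_of_nonpos p2 k2 (by linarith)) (by positivity) (by positivity)
    have hexp : Real.exp (-(c * x.1)) ≤ 1 := by
      rw [Real.exp_le_one_iff]; nlinarith
    have hsn : 0 ≤ s (x.2 - b) := by simp only [s]; positivity
    calc _ ≤ Real.exp (-(c * x.1)) * (2 * (1 + h (x.1 - l)) * s (x.2 - b)) := by
          gcongr
          exact k4.trans (by gcongr)
      _ = 2 * (Real.exp (-(c * x.1)) + Real.exp (-(c * x.1)) * h (x.1 - l)) * s (x.2 - b) := by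
          ring
      _ ≤ 2 * (Real.exp (-(c * x.1)) + 1 * h (x.1 - l)) * s (x.2 - b) := by
          gcongr
          exact hh0 _
      _ = _ := by ring

/-! ### The weight `|A| (√P / |g|)^κ` and its majorant. -/

section weight

variable {u : ℂ} {z : Fin 3 → ℂ} {x : ℝ × ℝ} {α β : ℝ}

lemma two_mul_sinh_eq (σ : ℝ) : 2 * Real.sinh σ = Real.exp σ * nvTau σ := by
  rw [nvTau, mul_sub, ← Real.exp_add, Real.sinh_eq]
  ring_nf

lemma norm_nvAmp_le {σ : ℝ} (hσ : 0 < σ) :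
    ‖nvAmp α β σ‖ ≤ 2 * (Real.exp ((2 + α) * σ) * nvTau σ ^ (1 + α)) := by
  have ht := nvTau_pos hσ
  have h2 : 2 * Real.sinh (2 * σ) ≤ 2 * (Real.exp (2 * σ) * nvTau σ) := by
    have e : nvTau (2 * σ) = nvTau σ * (1 + Real.exp (-(2 * σ))) := by
      rw [nvTau, nvTau, show -(2 * (2 * σ)) = -(2 * σ) + -(2 * σ) by ring, Real.exp_add]; ring
    rw [two_mul_sinh_eq, e]
    have : Real.exp (-(2 * σ)) ≤ 1 := by rw [Real.exp_le_one_iff]; linarith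
    calc _ = (1 + Real.exp (-(2 * σ))) * (Real.exp (2 * σ) * nvTau σ) := by ring
      _ ≤ _ := by gcongr; linarith
  rw [norm_nvAmp hσ, two_mul_sinh_eq]
  calc _ ≤ (Real.exp σ * nvTau σ) ^ α * (2 * (Real.exp (2 * σ) * nvTau σ)) := by gcongr
    _ = _ := by
      rw [Real.mul_rpow (Real.exp_pos _).le ht.le, ← Real.exp_mul, Real.rpow_add ht, Real.rpow_one,
        show (2 + α) * σ = σ * α + 2 * σ by ring, Real.exp_add]
      ring

lemma nvTau_le_norm_nvY {a : ℂ} (ha : ‖a‖ ≤ 1) (x : ℝ × ℝ) :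
    nvTau x.1 ≤ ‖nvY a (cylPoint x)‖ := by
  have h := norm_sub_norm_le (1 : ℂ) (a * Complex.exp (-(2 * cylPoint x)))
  have e : ‖Complex.exp (-(2 * cylPoint x))‖ = Real.exp (-(2 * x.1)) := by
    rw [Complex.norm_exp]; simp [cylPoint]
  rw [norm_one, norm_mul, e] at h
  have : ‖a‖ * Real.exp (-(2 * x.1)) ≤ 1 * Real.exp (-(2 * x.1)) := by gcongr
  rw [nvTau, nvY]
  linarith

/-- The elementary inequality behind the weighted estimate: `τ` may exceed only the first of the
three distances. -/
lemma rpow_mul_rpow_le {τ a b c s κ : ℝ} (hτ : 0 < τ) (ha : 0 < a) (hb : τ ≤ b) (hc : τ ≤ c)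
    (hs : 0 ≤ s) (hs1 : s ^ 2 ≤ (τ ^ 2)⁻¹ + ((a ^ 2)⁻¹ + (b ^ 2)⁻¹ + (c ^ 2)⁻¹))
    (hκ : 0 ≤ κ) (h1 : κ ≤ 1 + α) (h2 : 1 + α ≤ 2 * κ) :
    τ ^ (1 + α) * (s / (6 * (a * b * c))) ^ κ ≤
      a ^ (-(4 * κ - 1 - α)) + b ^ (-(4 * κ - 1 - α)) + c ^ (-(4 * κ - 1 - α)) := by
  have hb0 : 0 < b := hτ.trans_le hb
  have hc0 : 0 < c := hτ.trans_le hc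
  have hp : 0 ≤ 4 * κ - 1 - α := by linarith
  have hsr : ∀ r : ℝ, 0 < r → r ≤ τ → r ≤ a → r ≤ b → r ≤ c → s ≤ 2 / r := by
    intro r hr k1 k2 k3 k4
    refine abs_le_of_sq_le_sq' ?_ (by positivity) |>.2
    have e : ∀ y, r ≤ y → (y ^ 2)⁻¹ ≤ (r ^ 2)⁻¹ := fun y hy => by gcongr
    have := e _ k1; have := e _ k2; have := e _ k3; have := e _ k4
    have e2 : (2 / r) ^ 2 = 4 * (r ^ 2)⁻¹ := by field_simp; norm_num
    rw [e2]; linarith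
  rcases le_total τ a with h | h
  · -- all the distances are at least `τ`
    have main : ∀ d : ℝ, 0 < d → τ ≤ d → d ≤ a → d ≤ b → d ≤ c →
        τ ^ (1 + α) * (s / (6 * (a * b * c))) ^ κ ≤ d ^ (-(4 * κ - 1 - α)) := by
      intro d hd k0 k1 k2 k3
      have hs2 := hsr τ hτ le_rfl h hb hc
      have hq : s / (6 * (a * b * c)) ≤ τ⁻¹ * (d ^ 3)⁻¹ := by
        calc s / (6 * (a * b * c)) ≤ (2 / τ) / (2 * (d * d * d)) := by
              have k : d * d * d ≤ a * b * c := by gcongr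
              have : 0 < d * d * d := by positivity
              exact div_le_div₀ (by positivity) hs2 (by positivity) (by linarith)
          _ = _ := by field_simp
      calc _ ≤ τ ^ (1 + α) * (τ⁻¹ * (d ^ 3)⁻¹) ^ κ := by gcongr
        _ = τ ^ (1 + α - κ) * d ^ (-(3 * κ)) := by
            rw [Real.mul_rpow (by positivity) (by positivity), Real.rpow_sub hτ,
              Real.inv_rpow hτ.le, Real.inv_rpow (by positivity), ← Real.rpow_natCast,
              ← Real.rpow_mul hd.le, Real.rpow_neg hd.le]
            push_cast
            ring
        _ ≤ d ^ (1 + α - κ) * d ^ (-(3 * κ)) := by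
            gcongr
        _ = _ := by rw [← Real.rpow_add hd]; ring_nf
    have pa : 0 ≤ a ^ (-(4 * κ - 1 - α)) := by positivity
    have pb : 0 ≤ b ^ (-(4 * κ - 1 - α)) := by positivity
    have pc : 0 ≤ c ^ (-(4 * κ - 1 - α)) := by positivity
    rcases le_total a b with k | k
    · rcases le_total a c with k' | k'
      · linarith [main a ha h le_rfl k k']
      · linarith [main c hc0 hc k' (k'.trans k) le_rfl]
    · rcases le_total b c with k' | k'
      · linarith [main b hb0 hb k le_rfl k']
      · linarith [main c hc0 hc (k'.trans k) k' le_rfl]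
  -- Now `a` is the smallest distance. Bounding `b` and `c` below by `τ` leaves the nonpositive
  -- power `τ^{1+α-2κ}`, so `τ` may be lowered to `a`.
  · have hs2 := hsr a ha h le_rfl (h.trans hb) (h.trans hc)
    have hq : s / (6 * (a * b * c)) ≤ (a ^ 2)⁻¹ * (τ ^ 2)⁻¹ := by
      calc s / (6 * (a * b * c)) ≤ (2 / a) / (2 * (a * τ * τ)) := by
            have k : a * τ * τ ≤ a * b * c := by gcongr
            have : 0 < a * τ * τ := by positivity
            exact div_le_div₀ (by positivity) hs2 (by positivity) (by linarith)
        _ = _ := by field_simp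
    have : τ ^ (1 + α) * (s / (6 * (a * b * c))) ^ κ ≤ a ^ (-(4 * κ - 1 - α)) := by
      calc _ ≤ τ ^ (1 + α) * ((a ^ 2)⁻¹ * (τ ^ 2)⁻¹) ^ κ := by gcongr
        _ = a ^ (-(2 * κ)) * τ ^ (1 + α - 2 * κ) := by
            rw [Real.mul_rpow (by positivity) (by positivity), Real.rpow_sub hτ,
              Real.inv_rpow (by positivity), Real.inv_rpow (by positivity), ← Real.rpow_natCast,
              ← Real.rpow_natCast, ← Real.rpow_mul hτ.le, ← Real.rpow_mul ha.le,
              Real.rpow_neg ha.le]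
            push_cast
            ring
        _ ≤ a ^ (-(2 * κ)) * a ^ (1 + α - 2 * κ) := by
            exact mul_le_mul_of_nonneg_left
              (Real.rpow_le_rpow_of_nonpos ha h (by linarith)) (by positivity)
        _ = _ := by rw [← Real.rpow_add ha]; ring_nf
    have pb : 0 ≤ b ^ (-(4 * κ - 1 - α)) := by positivity
    have pc : 0 ≤ c ^ (-(4 * κ - 1 - α)) := by positivity
    linarith

/-- The exponentials `e^{(2+α)σ}` from `A` and `e^{3σ}` from `g` are factored out;
`rpow_mul_rpow_le` handles the distances. -/
lemma weight_le (hz : IsNVRoots u z) (hx : 0 < x.1) (hG : nvG u (cylPoint x) ≠ 0) {κ : ℝ}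
    (hκ : 0 ≤ κ) (h1 : κ ≤ 1 + α) (h2 : 1 + α ≤ 2 * κ) :
    ‖nvAmp α β x.1‖ * (√(nvP z x) / ‖nvG u (cylPoint x)‖) ^ κ ≤
      2 * ∑ k, Real.exp (-((3 * κ - 2 - α) * x.1)) *
        ‖nvY (z k) (cylPoint x)‖ ^ (-(4 * κ - 1 - α)) := by
  have ht := nvTau_pos hx
  have hy := hz.nvY_ne_zero hG
  have e3 : ‖Complex.exp (3 * cylPoint x)‖ = Real.exp (3 * x.1) := by
    rw [Complex.norm_exp]; simp [cylPoint]
  have eG : ‖nvG u (cylPoint x)‖ = Real.exp (3 * x.1) * (6 * (‖nvY (z 0) (cylPoint x)‖ *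
      ‖nvY (z 1) (cylPoint x)‖ * ‖nvY (z 2) (cylPoint x)‖)) := by
    rw [hz.eq_prod, Fin.prod_univ_three, norm_mul, norm_mul, e3]
    simp only [norm_mul, Complex.norm_ofNat]
    ring
  have hsq : √(nvP z x) ^ 2 ≤ (nvTau x.1 ^ 2)⁻¹ + ((‖nvY (z 0) (cylPoint x)‖ ^ 2)⁻¹ +
      (‖nvY (z 1) (cylPoint x)‖ ^ 2)⁻¹ + (‖nvY (z 2) (cylPoint x)‖ ^ 2)⁻¹) := by
    rw [Real.sq_sqrt (nvP_pos hx).le, nvP, Fin.sum_univ_three]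
  have key := rpow_mul_rpow_le (α := α) ht (norm_pos_iff.2 (hy 0))
    (nvTau_le_norm_nvY hz.norm_one_le x) (nvTau_le_norm_nvY hz.norm_two_le x)
    (Real.sqrt_nonneg (nvP z x)) hsq hκ h1 h2
  rw [eG, ← Finset.mul_sum, Fin.sum_univ_three]
  set s := √(nvP z x)
  set D := 6 * (‖nvY (z 0) (cylPoint x)‖ * ‖nvY (z 1) (cylPoint x)‖ * ‖nvY (z 2) (cylPoint x)‖)
  have hD : 0 ≤ s / D := by positivity
  calc _ ≤ 2 * (Real.exp ((2 + α) * x.1) * nvTau x.1 ^ (1 + α)) *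
        (s / (Real.exp (3 * x.1) * D)) ^ κ := by
        gcongr; exact norm_nvAmp_le hx
    _ = 2 * (Real.exp (-((3 * κ - 2 - α) * x.1)) * (nvTau x.1 ^ (1 + α) * (s / D) ^ κ)) := by
        rw [show s / (Real.exp (3 * x.1) * D) = Real.exp (-(3 * x.1)) * (s / D) by
            rw [Real.exp_neg]; field_simp,
          Real.mul_rpow (Real.exp_pos _).le hD, ← Real.exp_mul,
          show -((3 * κ - 2 - α) * x.1) = (2 + α) * x.1 + -(3 * x.1) * κ by ring, Real.exp_add]
        ring
    _ ≤ _ := by gcongr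

/-- The half cylinder. -/
def halfCyl : Set (ℝ × ℝ) := Set.Ioi 0 ×ˢ Set.Ioo (-Real.pi) Real.pi

/-- A majorant of the weight which is integrable uniformly in `u`. -/
lemma exists_weight_majorant {κ : ℝ} (hκ : 0 ≤ κ) (h1 : κ ≤ 1 + α) (h2 : 1 + α ≤ 2 * κ)
    (h3 : 2 + α < 3 * κ) (h4 : 4 * κ < 3 + α) :
    ∃ C : ℝ, 0 ≤ C ∧ ∀ (u : ℂ) (z : Fin 3 → ℂ), IsNVRoots u z → ∃ K : ℝ × ℝ → ℝ,
      IntegrableOn K halfCyl ∧ ∫ x in halfCyl, K x ≤ C ∧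
      ∀ᵐ x, 0 < x.1 → nvG u (cylPoint x) ≠ 0 → ∀ β : ℝ,
        ‖nvAmp α β x.1‖ * (√(nvP z x) / ‖nvG u (cylPoint x)‖) ^ κ ≤ K x := by
  obtain ⟨C, hC, h⟩ := exists_kernel_bound (c := 3 * κ - 2 - α) (p := 4 * κ - 1 - α)
    (by linarith) (by linarith) (by linarith)
  refine ⟨6 * C, by positivity, fun u z hz => ?_⟩
  choose K hK1 hK2 hK3 using fun k => h (z k) (hz.ne_zero k)
  refine ⟨fun x => 2 * ∑ k, K k x, ?_, ?_, ?_⟩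
  · exact (integrable_finsetSum _ fun k _ => hK1 k).const_mul 2
  · rw [integral_const_mul]
    have e : ∫ x in halfCyl, ∑ k, K k x = ∑ k, ∫ x in halfCyl, K k x :=
      integral_finsetSum _ fun k _ => hK1 k
    rw [e]
    have : ∑ k, ∫ x in halfCyl, K k x ≤ ∑ _k : Fin 3, C := Finset.sum_le_sum fun k _ => hK2 k
    simp at this
    linarith
  · filter_upwards [ae_all_iff.2 hK3] with x hx hx0 hG β
    refine (weight_le hz hx0 hG hκ h1 h2).trans ?_
    gcongr with k
    exact hx k hx0

end weight

/-! ### Integration by parts on the truncated cylinder. -/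

section cylinder

variable {u : ℂ} {z : Fin 3 → ℂ} {α β t : ℝ}

lemma continuous_cylPoint : Continuous cylPoint := by unfold cylPoint; fun_prop

lemma continuous_nvG (u : ℂ) : Continuous (nvG u) := by unfold nvG; fun_prop

lemma continuous_nvPhi (u : ℂ) : Continuous (nvPhi u) := by unfold nvPhi; fun_prop

lemma cylPoint_injective : Function.Injective cylPoint := fun x y h => by
  have h1 := congrArg Complex.re h
  have h2 := congrArg Complex.im h
  simp [cylPoint] at h1 h2
  exact Prod.ext h1 h2

lemma continuous_nvOsc (t : ℝ) (u : ℂ) : Continuous (nvOsc t u) := by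
  have := (continuous_nvPhi u).comp continuous_cylPoint
  have h2 : Continuous fun x => (nvPhi u (cylPoint x)).re := Complex.continuous_re.comp this
  unfold nvOsc
  fun_prop

lemma measurable_nvAmp (α β : ℝ) : Measurable (nvAmp α β) := by
  unfold nvAmp
  have h1 : Measurable fun σ : ℝ => ((2 * Real.sinh σ : ℝ) : ℂ) :=
    Complex.measurable_ofReal.comp (Real.continuous_sinh.measurable.const_mul 2)
  have h2 : Measurable fun σ : ℝ => ((2 * Real.sinh (2 * σ) : ℝ) : ℂ) :=
    Complex.measurable_ofReal.comp
      ((Real.continuous_sinh.measurable.comp (measurable_id.const_mul 2)).const_mul 2)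
  exact (h1.pow_const _).mul h2

lemma norm_nvAmp_of_nonneg {σ : ℝ} (hσ : 0 ≤ σ) :
    ‖nvAmp α β σ‖ = (2 * Real.sinh σ) ^ α * (2 * Real.sinh (2 * σ)) := by
  rcases hσ.eq_or_lt with rfl | h
  · simp [nvAmp]
  · exact norm_nvAmp h

lemma continuous_norm_nvAmp (hα : 0 ≤ α) :
    Continuous fun σ : ℝ => (2 * Real.sinh σ) ^ α * (2 * Real.sinh (2 * σ)) := by
  have h1 : Continuous fun σ : ℝ => 2 * Real.sinh σ := by fun_prop
  have h2 : Continuous fun σ : ℝ => 2 * Real.sinh (2 * σ) := by fun_prop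
  exact (h1.rpow_const fun _ => .inr hα).mul h2

lemma countable_zeros (hz : IsNVRoots u z) : {x | nvG u (cylPoint x) = 0}.Countable := by
  have h1 : ∀ a : ℂ, {w : ℂ | nvY a w = 0}.Countable := by
    intro a
    by_cases hne : ({w : ℂ | nvY a w = 0}).Nonempty
    · obtain ⟨w₀, h0⟩ := hne
      refine (Set.countable_range fun n : ℤ => w₀ - n * (Real.pi * Complex.I)).mono ?_
      intro w hw
      simp only [Set.mem_ofPred_eq, nvY, sub_eq_zero] at h0 hw
      have ha : a ≠ 0 := by rintro rfl; simp at hw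
      have := mul_left_cancel₀ ha (h0.symm.trans hw)
      obtain ⟨n, hn⟩ := Complex.exp_eq_exp_iff_exists_int.1 this
      exact ⟨-n, by push_cast; linear_combination -hn / 2⟩
    · rw [Set.not_nonempty_iff_eq_empty.1 hne]; exact Set.countable_empty
  have h2 : {w : ℂ | nvG u w = 0}.Countable := by
    refine (Set.countable_iUnion fun k => h1 (z k)).mono fun w hw => ?_
    have hw' : nvG u w = 0 := hw
    rw [hz.eq_prod] at hw'
    have := (mul_eq_zero.1 hw').resolve_left (mul_ne_zero (by norm_num) (Complex.exp_ne_zero _))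
    obtain ⟨k, -, hk⟩ := Finset.prod_eq_zero_iff.1 this
    exact Set.mem_iUnion.2 ⟨k, hk⟩
  exact h2.preimage_of_injOn cylPoint_injective.injOn

lemma norm_nvF_le_of_nonneg {x : ℝ × ℝ} (hx : 0 ≤ x.1) (ht : 0 < t) :
    ‖nvF α β t u z x‖ ≤ t ^ 2 * ((2 * Real.sinh x.1) ^ α * (2 * Real.sinh (2 * x.1)) *
      ‖nvG u (cylPoint x)‖) := by
  rcases hx.eq_or_lt with h | h
  · simp [nvF, nvAmp, ← h]
  · rw [← norm_nvAmp (β := β) h]; exact norm_nvF_le h ht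

/-- At the zeros of `g` and on `σ = 0`, where differentiability is not available, `nvF` is squeezed
to `0` by a continuous majorant. -/
lemma continuousOn_nvF (hz : IsNVRoots u z) (ht : 0 < t) (hα₀ : 0 ≤ α) (hα₁ : α ≤ 1) :
    ContinuousOn (nvF α β t u z) {x | 0 ≤ x.1} := by
  intro x hx
  by_cases h : 0 < x.1 ∧ nvG u (cylPoint x) ≠ 0
  · exact (differentiableAt_nvF_and_norm_sub_le hz h.1 ht h.2 hα₀ hα₁ zero_le_one
      le_rfl).1.continuousAt.continuousWithinAt
  · have hcont : Continuous fun x : ℝ × ℝ => t ^ 2 * ((2 * Real.sinh x.1) ^ α *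
        (2 * Real.sinh (2 * x.1)) * ‖nvG u (cylPoint x)‖) :=
      continuous_const.mul (((continuous_norm_nvAmp hα₀).comp continuous_fst).mul
        ((continuous_nvG u).comp continuous_cylPoint).norm)
    have h0 : t ^ 2 * ((2 * Real.sinh x.1) ^ α * (2 * Real.sinh (2 * x.1)) *
        ‖nvG u (cylPoint x)‖) = 0 := by
      by_cases hx0 : 0 < x.1
      · have : nvG u (cylPoint x) = 0 := by_contra fun hG => h ⟨hx0, hG⟩
        simp [this]
      · have : x.1 = 0 := le_antisymm (not_lt.1 hx0) hx
        simp [this]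
    have hF : nvF α β t u z x = 0 := by
      rw [← norm_le_zero_iff, ← h0]; exact norm_nvF_le_of_nonneg hx ht
    have hlim := hcont.tendsto x
    rw [h0] at hlim
    rw [ContinuousWithinAt, hF]
    exact squeeze_zero_norm' (eventually_nhdsWithin_of_forall fun y hy =>
      norm_nvF_le_of_nonneg hy ht) (hlim.mono_left nhdsWithin_le_nhds)

lemma nvF_pi_eq (σ : ℝ) : nvF α β t u z (σ, Real.pi) = nvF α β t u z (σ, -Real.pi) := by
  have e : cylPoint (σ, Real.pi) = cylPoint (σ, -Real.pi) + 2 * Real.pi * Complex.I := by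
    simp only [cylPoint]; push_cast; ring
  have hexp : ∀ n : ℤ, Complex.exp (n * cylPoint (σ, Real.pi)) =
      Complex.exp (n * cylPoint (σ, -Real.pi)) := fun n => by
    rw [Complex.exp_eq_exp_iff_exists_int]
    exact ⟨n, by rw [e]; ring⟩
  have e1 := hexp 1
  have e2 := hexp (-1)
  have e3 := hexp 3
  have e4 := hexp (-3)
  have e5 := hexp (-2)
  simp only [Int.cast_neg, Int.cast_one, Int.cast_ofNat, one_mul, neg_mul] at e1 e2 e3 e4 e5
  simp only [nvF, nvM, nvOsc, nvPhi, nvG, nvP, nvY, e1, e2, e3, e4, e5]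

/-- The remainder after integration by parts. -/
noncomputable def nvB (α β t : ℝ) (u : ℂ) (z : Fin 3 → ℂ) (x : ℝ × ℝ) : ℂ :=
  nvAmp α β x.1 * nvOsc t u x - (Complex.I * t)⁻¹ * dbar (nvF α β t u z) x

lemma measurable_nvAmp_mul_nvOsc (α β t : ℝ) (u : ℂ) :
    Measurable fun x : ℝ × ℝ => nvAmp α β x.1 * nvOsc t u x :=
  ((measurable_nvAmp α β).comp measurable_fst).mul (continuous_nvOsc t u).measurable

lemma measurable_nvB : Measurable (nvB α β t u z) :=
  (measurable_nvAmp_mul_nvOsc α β t u).sub ((measurable_dbar _).const_mul _)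

/-- The half cylinder truncated at height `L`. -/
def cylRect (L : ℝ) : Set (ℝ × ℝ) := Set.Ioo 0 L ×ˢ Set.Ioo (-Real.pi) Real.pi

lemma measurableSet_cylRect (L : ℝ) : MeasurableSet (cylRect L) :=
  measurableSet_Ioo.prod measurableSet_Ioo

lemma measurableSet_halfCyl : MeasurableSet halfCyl :=
  measurableSet_Ioi.prod measurableSet_Ioo

lemma cylRect_subset (L : ℝ) : cylRect L ⊆ halfCyl :=
  Set.prod_mono Set.Ioo_subset_Ioi_self le_rfl

lemma integrableOn_nvAmp_mul_nvOsc (hα : 0 ≤ α) (L : ℝ) :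
    IntegrableOn (fun x : ℝ × ℝ => nvAmp α β x.1 * nvOsc t u x) (cylRect L) := by
  obtain ⟨M, hM⟩ := (isCompact_Icc (a := (0 : ℝ)) (b := L)).exists_bound_of_continuousOn
    (continuous_norm_nvAmp hα).continuousOn
  refine Measure.integrableOn_of_bounded (M := M) ?_
    (measurable_nvAmp_mul_nvOsc α β t u).aestronglyMeasurable ?_
  · rw [cylRect, Measure.volume_eq_prod, Measure.prod_prod]
    exact ENNReal.mul_ne_top (by simp) (by simp)
  · filter_upwards [ae_restrict_mem (measurableSet_cylRect L)] with x hx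
    rw [norm_mul, norm_nvOsc, mul_one, norm_nvAmp_of_nonneg hx.1.1.le]
    exact (le_abs_self _).trans (hM x.1 ⟨hx.1.1.le, hx.1.2.le⟩)

/-- The divergence theorem for the field `(F, iF)`, whose divergence is `dbar F`, allowing a
countable exceptional set. The sides `θ = ±π` cancel by periodicity and the side `σ = 0` drops out
with the amplitude. -/
lemma setIntegral_cylRect_eq (hz : IsNVRoots u z) (ht : 0 < t) (hα₀ : 0 ≤ α) (hα₁ : α ≤ 1)
    (hB : IntegrableOn (nvB α β t u z) halfCyl) {L : ℝ} (hL : 0 < L) :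
    ∫ x in cylRect L, nvAmp α β x.1 * nvOsc t u x =
      (∫ x in cylRect L, nvB α β t u z x) +
        (Complex.I * t)⁻¹ * ∫ y in (-Real.pi)..Real.pi, nvF α β t u z (L, y) := by
  have hpi := Real.pi_pos
  have hIt : Complex.I * (t : ℂ) ≠ 0 :=
    mul_ne_zero Complex.I_ne_zero (by exact_mod_cast ht.ne')
  have hA := integrableOn_nvAmp_mul_nvOsc (β := β) (t := t) (u := u) hα₀ L
  have hBL := hB.mono_set (cylRect_subset L)
  -- Integrability of `dbar F` is read off from that of the remainder and of the bounded integrand,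
  -- instead of being estimated directly.
  have hD : IntegrableOn (dbar (nvF α β t u z)) (cylRect L) := by
    refine ((hA.sub hBL).const_mul (Complex.I * t)).congr (Eventually.of_forall fun x => ?_)
    change Complex.I * t * (nvAmp α β x.1 * nvOsc t u x - nvB α β t u z x) = _
    rw [nvB, sub_sub_cancel, mul_inv_cancel_left₀ hIt]
  have hcont : ContinuousOn (nvF α β t u z)
      (Set.uIcc 0 L ×ˢ Set.uIcc (-Real.pi) Real.pi) := by
    refine (continuousOn_nvF hz ht hα₀ hα₁).mono fun x hx => ?_
    rw [Set.uIcc_of_le hL.le] at hx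
    exact hx.1.1
  have hdiff : ∀ x ∈ Set.Ioo (min 0 L) (max 0 L) ×ˢ
      Set.Ioo (min (-Real.pi) Real.pi) (max (-Real.pi) Real.pi) \ {x | nvG u (cylPoint x) = 0},
      HasFDerivAt (nvF α β t u z) (fderiv ℝ (nvF α β t u z) x) x := by
    intro x hx
    rw [min_eq_left hL.le] at hx
    exact (differentiableAt_nvF_and_norm_sub_le hz hx.1.1.1 ht hx.2 hα₀ hα₁ zero_le_one
      le_rfl).1.hasFDerivAt
  have hae : (Set.uIcc 0 L ×ˢ Set.uIcc (-Real.pi) Real.pi : Set (ℝ × ℝ)) =ᵐ[volume] cylRect L := by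
    rw [Set.uIcc_of_le hL.le, Set.uIcc_of_le (by linarith), Measure.volume_eq_prod]
    exact Measure.set_prod_ae_eq Ioo_ae_eq_Icc.symm Ioo_ae_eq_Icc.symm
  have hdiv := integral2_divergence_prod_of_hasFDerivAt_off_countable (nvF α β t u z)
    (fun x => Complex.I * nvF α β t u z x) (fderiv ℝ (nvF α β t u z))
    (fun x => Complex.I • fderiv ℝ (nvF α β t u z) x) 0 (-Real.pi) L Real.pi _
    (countable_zeros hz) hcont (continuousOn_const.mul hcont) hdiff
    (fun x hx => (hdiff x hx).const_mul Complex.I) (hD.congr_set_ae hae)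
  have hsum : ∀ x : ℝ × ℝ, fderiv ℝ (nvF α β t u z) x (1, 0) +
      (Complex.I • fderiv ℝ (nvF α β t u z) x) (0, 1) = dbar (nvF α β t u z) x := fun x => rfl
  simp only [hsum, nvF_pi_eq, sub_self, zero_add] at hdiv
  have h0 : ∀ y, nvF α β t u z (0, y) = 0 := fun y => by simp [nvF, nvAmp]
  simp only [h0, intervalIntegral.integral_zero, sub_zero] at hdiv
  have hDint : ∫ x in cylRect L, dbar (nvF α β t u z) x =
      ∫ y in (-Real.pi)..Real.pi, nvF α β t u z (L, y) := by
    rw [← hdiv, intervalIntegral.integral_of_le hL.le, integral_Ioc_eq_integral_Ioo, cylRect,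
      Measure.volume_eq_prod, setIntegral_prod _ hD]
    refine setIntegral_congr_fun measurableSet_Ioo fun x _ => ?_
    rw [intervalIntegral.integral_of_le (by linarith), integral_Ioc_eq_integral_Ioo]
  rw [← hDint, ← integral_const_mul, ← integral_add hBL (hD.const_mul _)]
  refine setIntegral_congr_fun (measurableSet_cylRect L) fun x _ => ?_
  simp only [nvB]
  ring

/-- At height `L` the amplitude is `O(e^{(2+α)L})` while `|g| ≥ e^{3L} / 2` eventually, so `α < 1`
gives decay for each fixed `u`; no uniformity in `u` is needed. -/
lemma tendsto_boundary (hz : IsNVRoots u z) (hα₀ : 0 ≤ α) (hα₁ : α < 1) :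
    Tendsto (fun L => ∫ y in (-Real.pi)..Real.pi, nvF α β t u z (L, y)) atTop (𝓝 0) := by
  have hlim : ∀ a : ℂ, Tendsto (fun L : ℝ => ‖a‖ * Real.exp (-(2 * L))) atTop (𝓝 0) := by
    intro a
    have h1 : Tendsto (fun L : ℝ => 2 * L) atTop atTop := tendsto_id.const_mul_atTop (by norm_num)
    simpa using (Real.tendsto_exp_neg_atTop_nhds_zero.comp h1).const_mul ‖a‖
  have hev : ∀ᶠ L in atTop, ∀ k, ‖z k‖ * Real.exp (-(2 * L)) ≤ 1 / 2 :=
    eventually_all.2 fun k => (hlim (z k)).eventually_le_const (by norm_num)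
  have hexp : Tendsto (fun L : ℝ => 8 * Real.exp (-((1 - α) * L)) * |Real.pi - -Real.pi|)
      atTop (𝓝 0) := by
    have h1 : Tendsto (fun L : ℝ => (1 - α) * L) atTop atTop :=
      tendsto_id.const_mul_atTop (by linarith)
    simpa using ((Real.tendsto_exp_neg_atTop_nhds_zero.comp h1).const_mul 8).mul_const
      |Real.pi - -Real.pi|
  refine squeeze_zero_norm' ?_ hexp
  filter_upwards [hev, eventually_gt_atTop 0] with L hL hL0
  refine intervalIntegral.norm_integral_le_of_norm_le_const fun y _ => ?_
  have hG : Real.exp (3 * L) / 2 ≤ ‖nvG u (cylPoint (L, y))‖ := by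
    have e3 : ‖Complex.exp (3 * cylPoint (L, y))‖ = Real.exp (3 * L) := by
      rw [Complex.norm_exp]; simp [cylPoint]
    have hY : ∀ k, 1 / 2 ≤ ‖nvY (z k) (cylPoint (L, y))‖ := by
      intro k
      have h := norm_sub_norm_le (1 : ℂ) (z k * Complex.exp (-(2 * cylPoint (L, y))))
      have e : ‖Complex.exp (-(2 * cylPoint (L, y)))‖ = Real.exp (-(2 * L)) := by
        rw [Complex.norm_exp]; simp [cylPoint]
      rw [norm_one, norm_mul, e] at h
      have := hL k
      rw [nvY]; linarith
    rw [hz.eq_prod, Fin.prod_univ_three, norm_mul, norm_mul, e3, norm_mul, norm_mul,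
      Complex.norm_ofNat]
    calc Real.exp (3 * L) / 2 ≤ 6 * Real.exp (3 * L) * (1 / 2 * (1 / 2) * (1 / 2)) := by
          have := Real.exp_pos (3 * L); linarith
      _ ≤ _ := by gcongr <;> exact hY _
  refine (norm_nvF_le_div (x := (L, y)) hL0).trans ?_
  have hA : ‖nvAmp α β L‖ ≤ 4 * Real.exp ((2 + α) * L) := by
    have h1 : nvTau L ^ (1 + α) ≤ 1 :=
      Real.rpow_le_one (nvTau_pos hL0).le (nvTau_lt_one L).le (by linarith)
    have h2 := Real.exp_pos ((2 + α) * L)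
    refine (norm_nvAmp_le hL0).trans ?_
    nlinarith
  calc _ ≤ 4 * Real.exp ((2 + α) * L) * (Real.exp (3 * L) / 2)⁻¹ := by
        gcongr
    _ = _ := by
        rw [show -((1 - α) * L) = (2 + α) * L - 3 * L by ring, Real.exp_sub]
        field_simp
        norm_num

end cylinder

/-! ### Passage to cylinder coordinates and the bound at energy `-1`. -/

/-- With `r = 2 sinh σ`, the identity `r³ + 3r = 2 sinh 3σ` turns the symbol into `4 sinh 3σ cos
3θ`, a harmonic function. -/
lemma nvPhase_sinh {σ θ : ℝ} (hσ : 0 < σ) (u : ℂ) :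
    nvPhase (-1) u (((2 * Real.sinh σ : ℝ) : ℂ) * (Real.cos θ + Real.sin θ * Complex.I)) =
      ((nvPhi u (cylPoint (σ, θ))).re : ℂ) := by
  have hs : 0 < 2 * Real.sinh σ := by have := Real.sinh_pos_iff.2 hσ; positivity
  set a : ℂ := Complex.exp σ
  set e : ℂ := Complex.exp (θ * Complex.I)
  have ha : a ≠ 0 := Complex.exp_ne_zero _
  have he : e ≠ 0 := Complex.exp_ne_zero _
  have hce : conj e = e⁻¹ := by
    rw [← Complex.exp_conj, ← Complex.exp_neg]; simp
  have hca : conj a = a := by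
    rw [← Complex.exp_conj]; simp [a]
  have hr : ((2 * Real.sinh σ : ℝ) : ℂ) = a - a⁻¹ := by
    rw [← Complex.exp_neg]
    push_cast
    rw [Complex.sinh]
    ring
  have hcs : (Real.cos θ + Real.sin θ * Complex.I : ℂ) = e := by
    push_cast
    exact (Complex.exp_mul_I _).symm
  have hr0 : a - a⁻¹ ≠ 0 := by rw [← hr]; exact_mod_cast hs.ne'
  have hn : ((‖(a - a⁻¹) * e‖ : ℝ) : ℂ) = a - a⁻¹ := by
    rw [norm_mul, Complex.norm_exp_ofReal_mul_I, mul_one, ← hr, Complex.norm_real,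
      Real.norm_of_nonneg hs.le]
  have hw : Complex.exp (cylPoint (σ, θ)) = a * e := by
    rw [cylPoint, Complex.exp_add]
  have h3 : Complex.exp (3 * cylPoint (σ, θ)) = (a * e) ^ 3 := by
    rw [← hw, ← Complex.exp_nat_mul]; norm_num
  have hre : ((nvPhi u (cylPoint (σ, θ))).re : ℂ) =
      (nvPhi u (cylPoint (σ, θ)) + conj (nvPhi u (cylPoint (σ, θ)))) / 2 := by
    rw [Complex.add_conj]; push_cast; ring
  have h12 : (1 - 3 * ((-1 : ℝ) : ℂ) / (a - a⁻¹) ^ 2) = ((a - a⁻¹) ^ 2 + 3) / (a - a⁻¹) ^ 2 := by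
    clear_value a
    generalize a - a⁻¹ = r at hr0
    field_simp; push_cast; ring
  rw [hre, nvPhase, nvSymbol, hr, hcs, hn, h12]
  simp only [nvPhi, Complex.exp_neg, h3, hw, map_sub, map_add, map_mul, map_inv₀, map_pow,
    hce, hca, Complex.conj_conj, map_ofNat]
  have e1 : (((a - a⁻¹) * e) ^ 3 + ((a - a⁻¹) * e⁻¹) ^ 3) *
      (((a - a⁻¹) ^ 2 + 3) / (a - a⁻¹) ^ 2) =
      (e ^ 3 + e⁻¹ ^ 3) * ((a - a⁻¹) ^ 3 + 3 * (a - a⁻¹)) := by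
    generalize a - a⁻¹ = r at hr0
    field_simp
  rw [e1]
  field_simp
  ring

/-- Polar coordinates followed by `r = 2 sinh σ`: the Jacobian `r dr = 2 sinh(2σ) dσ` is the second
factor of `nvAmp`. -/
lemma nvTruncatedIntegral_eq_cyl (α β t : ℝ) (u : ℂ) {L : ℝ} :
    nvTruncatedIntegral α β (-1) t u (2 * Real.sinh L) =
      ∫ x in Set.Ioo 0 L ×ˢ Set.Ioo (-Real.pi) Real.pi, nvAmp α β x.1 * nvOsc t u x := by
  have hball : MeasurableSet (Metric.ball (0 : ℂ) (2 * Real.sinh L)) := Metric.isOpen_ball.measurableSet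
  have h1 : nvTruncatedIntegral α β (-1) t u (2 * Real.sinh L) =
      ∫ p in Set.Ioo 0 (2 * Real.sinh L) ×ˢ Set.Ioo (-Real.pi) Real.pi,
        p.1 • nvIntegrand α β (-1) t u (Complex.polarCoord.symm p) := by
    rw [nvTruncatedIntegral, ← integral_indicator hball, ← Complex.integral_comp_polarCoord_symm]
    rw [← integral_indicator (measurableSet_Ioo.prod measurableSet_Ioo),
      ← integral_indicator polarCoord.open_target.measurableSet]
    congr 1
    funext p
    simp only [Set.indicator, Set.mem_prod, Set.mem_Ioo, Set.mem_Ioi, polarCoord_target,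
      mem_ball_zero_iff, Complex.norm_polarCoord_symm]
    by_cases hp : 0 < p.1
    · simp only [abs_of_pos hp, hp, true_and]
      split_ifs <;> simp_all
    · simp [hp]
  have hdiff : ∀ x ∈ Set.Ioo 0 L ×ˢ Set.Ioo (-Real.pi) Real.pi,
      HasFDerivWithinAt (Prod.map (fun s => 2 * Real.sinh s) id)
        (((2 * Real.cosh x.1) • ContinuousLinearMap.id ℝ ℝ).prodMap (ContinuousLinearMap.id ℝ ℝ))
        (Set.Ioo 0 L ×ˢ Set.Ioo (-Real.pi) Real.pi) x := by
    intro x _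
    refine (HasFDerivAt.prodMap (p := x) ?_ (hasFDerivAt_id _)).hasFDerivWithinAt
    have := ((Real.hasDerivAt_sinh x.1).const_mul 2).hasFDerivAt
    exact this.congr_fderiv (by ext; simp)
  have hinj : Set.InjOn (Prod.map (fun s => 2 * Real.sinh s) (id : ℝ → ℝ))
      (Set.Ioo 0 L ×ˢ Set.Ioo (-Real.pi) Real.pi) := by
    refine Function.Injective.injOn (Function.Injective.prodMap (fun a b h => ?_) fun _ _ h => h)
    exact Real.sinh_injective (by simpa using h)
  have himg : Prod.map (fun s => 2 * Real.sinh s) (id : ℝ → ℝ) ''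
      (Set.Ioo 0 L ×ˢ Set.Ioo (-Real.pi) Real.pi) =
      Set.Ioo 0 (2 * Real.sinh L) ×ˢ Set.Ioo (-Real.pi) Real.pi := by
    rw [Set.prodMap_image_prod, Set.image_id]
    congr 1
    ext r
    constructor
    · rintro ⟨s, hs, rfl⟩
      have h1 := Real.sinh_pos_iff.2 hs.1
      have h2 := Real.sinh_lt_sinh.2 hs.2
      exact ⟨by simpa using h1, by simpa using h2⟩
    · intro hr
      refine ⟨Real.arsinh (r / 2), ⟨Real.arsinh_pos_iff.2 (half_pos hr.1), ?_⟩, ?_⟩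
      · rw [← Real.sinh_lt_sinh, Real.sinh_arsinh]; linarith [hr.2]
      · simp only [Real.sinh_arsinh]; ring
  rw [h1, ← himg, integral_image_eq_integral_abs_det_fderiv_smul volume
    (measurableSet_Ioo.prod measurableSet_Ioo) hdiff hinj]
  refine setIntegral_congr_fun (measurableSet_Ioo.prod measurableSet_Ioo) fun x hx => ?_
  have hσ : 0 < x.1 := hx.1.1
  have hs := Real.sinh_pos_iff.2 hσ
  have hc := Real.cosh_pos x.1
  have hdet : (((2 * Real.cosh x.1) • ContinuousLinearMap.id ℝ ℝ).prodMap
      (ContinuousLinearMap.id ℝ ℝ)).det = 2 * Real.cosh x.1 := by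
    change LinearMap.det (LinearMap.prodMap ((2 * Real.cosh x.1) • (LinearMap.id : ℝ →ₗ[ℝ] ℝ))
      (LinearMap.id : ℝ →ₗ[ℝ] ℝ)) = _
    rw [LinearMap.det_prodMap]
    simp
  have hn : ‖((2 * Real.sinh x.1 : ℝ) : ℂ) * (Real.cos x.2 + Real.sin x.2 * Complex.I)‖ =
      2 * Real.sinh x.1 := by
    rw [Complex.ofReal_cos, Complex.ofReal_sin, ← Complex.exp_mul_I, norm_mul,
      Complex.norm_exp_ofReal_mul_I, mul_one, Complex.norm_real,
      Real.norm_of_nonneg (by positivity)]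
  have hph := nvPhase_sinh (θ := x.2) hσ u
  simp only [hdet, Prod.map_fst, Prod.map_snd, id, nvIntegrand,
    Complex.polarCoord_symm_apply, Complex.real_smul, hph, hn]
  rw [abs_of_pos (by positivity), nvAmp, nvOsc, Real.sinh_two_mul]
  push_cast
  ring

lemma exists_limit_energy_neg_one {α κ : ℝ} (hα₀ : 0 ≤ α) (hα₁ : α < 1) (hκ₀ : 0 ≤ κ)
    (hκ₁ : κ ≤ 1) (h2 : 1 + α ≤ 2 * κ) (h3 : 2 + α < 3 * κ) (h4 : 4 * κ < 3 + α) :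
    ∃ C : ℝ, 0 < C ∧ ∀ (β t : ℝ), 0 < t → ∀ u : ℂ, ∃ I : ℂ,
      Tendsto (nvTruncatedIntegral α β (-1) t u) atTop (𝓝 I) ∧
        ‖I‖ ≤ C * ((1 + |β|) / t ^ κ) := by
  obtain ⟨C, hC, hmaj⟩ := exists_weight_majorant hκ₀ (by linarith) h2 h3 h4
  -- The added `1` only secures strict positivity, as `C` may vanish.
  refine ⟨35 * C + 1, by positivity, fun β t ht u => ?_⟩
  obtain ⟨z, hz⟩ := exists_isNVRoots u
  obtain ⟨K, hK, hKC, hKle⟩ := hmaj u z hz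
  have hBle : ∀ᵐ x ∂volume.restrict halfCyl,
      ‖nvB α β t u z x‖ ≤ 35 * (1 + |β|) / t ^ κ * K x := by
    filter_upwards [ae_restrict_mem measurableSet_halfCyl, ae_restrict_of_ae hKle,
      ae_restrict_of_ae ((countable_zeros hz).ae_notMem volume)] with x hx hxK hG
    have hx0 : 0 < x.1 := hx.1
    refine (differentiableAt_nvF_and_norm_sub_le hz hx0 ht hG hα₀ hα₁.le hκ₀ hκ₁).2.trans ?_
    have e : √(nvP z x) / (t * ‖nvG u (cylPoint x)‖) =
        √(nvP z x) / ‖nvG u (cylPoint x)‖ / t := by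
      rw [div_div, mul_comm]
    rw [e, Real.div_rpow (by positivity) ht.le]
    calc _ = 35 * (1 + |β|) / t ^ κ *
          (‖nvAmp α β x.1‖ * (√(nvP z x) / ‖nvG u (cylPoint x)‖) ^ κ) := by ring
      _ ≤ _ := by gcongr; exact hxK hx0 hG β
  have hBint : IntegrableOn (nvB α β t u z) halfCyl :=
    (hK.const_mul _).mono' measurable_nvB.aestronglyMeasurable hBle
  refine ⟨∫ x in halfCyl, nvB α β t u z x, ?_, ?_⟩
  · have hmain : Tendsto (fun L => ∫ x in cylRect L, nvB α β t u z x) atTop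
        (𝓝 (∫ x in halfCyl, nvB α β t u z x)) := by
      have e : ∀ L, ∫ x in cylRect L, nvB α β t u z x =
          ∫ x in halfCyl, (cylRect L).indicator (nvB α β t u z) x := fun L => by
        rw [setIntegral_indicator (measurableSet_cylRect L),
          Set.inter_eq_right.2 (cylRect_subset L)]
      simp only [e]
      refine tendsto_integral_filter_of_dominated_convergence (fun x => ‖nvB α β t u z x‖)
        (Eventually.of_forall fun L =>
          (measurable_nvB.indicator (measurableSet_cylRect L)).aestronglyMeasurable)
        (Eventually.of_forall fun L => Eventually.of_forall fun x =>
          norm_indicator_le_norm_self _ _) hBint.norm ?_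
      filter_upwards [ae_restrict_mem measurableSet_halfCyl] with x hx
      refine tendsto_const_nhds.congr' ?_
      filter_upwards [eventually_gt_atTop x.1] with L hL
      exact (Set.indicator_of_mem (show x ∈ cylRect L from ⟨⟨hx.1, hL⟩, hx.2⟩) _).symm
    have hL : Tendsto (fun L => nvTruncatedIntegral α β (-1) t u (2 * Real.sinh L)) atTop
        (𝓝 (∫ x in halfCyl, nvB α β t u z x)) := by
      have h := hmain.add
        ((tendsto_boundary (β := β) (t := t) hz hα₀ hα₁).const_mul (Complex.I * t)⁻¹)
      rw [mul_zero, add_zero] at h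
      refine h.congr' ?_
      filter_upwards [eventually_gt_atTop 0] with L hL
      rw [nvTruncatedIntegral_eq_cyl]
      exact (setIntegral_cylRect_eq hz ht hα₀ hα₁.le hBint hL).symm
    have hars : Tendsto (fun R : ℝ => Real.arsinh (R / 2)) atTop atTop :=
      Real.sinhOrderIso.symm.tendsto_atTop.comp (tendsto_id.atTop_div_const two_pos)
    refine (hL.comp hars).congr fun R => ?_
    simp only [Function.comp_apply, Real.sinh_arsinh]
    rw [mul_div_cancel₀ R two_ne_zero]
  · have h35 : 0 ≤ (1 + |β|) / t ^ κ := by positivity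
    calc _ ≤ ∫ x in halfCyl, 35 * (1 + |β|) / t ^ κ * K x :=
          norm_integral_le_of_norm_le (hK.const_mul _) hBle
      _ = 35 * ((1 + |β|) / t ^ κ) * ∫ x in halfCyl, K x := by
          rw [integral_const_mul]; ring
      _ ≤ 35 * ((1 + |β|) / t ^ κ) * C := by gcongr
      _ ≤ _ := by nlinarith

/-! ### Scaling to arbitrary negative energy, and the conclusion. -/

lemma nvPhase_smul {E l : ℝ} (hl : 0 < l) (hE : E = -l ^ 2) (u ξ : ℂ) :
    nvPhase E u (l • ξ) = (l : ℂ) ^ 3 * nvPhase (-1) (u / (l : ℂ) ^ 2) ξ := by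
  have hl' : (l : ℂ) ≠ 0 := by exact_mod_cast hl.ne'
  have hn : ((‖l • ξ‖ : ℝ) : ℂ) = l * ((‖ξ‖ : ℝ) : ℂ) := by
    rw [norm_smul, Real.norm_of_nonneg hl.le]; push_cast; rfl
  have hq : 3 * (E : ℂ) / (l * ((‖ξ‖ : ℝ) : ℂ)) ^ 2 = 3 * ((-1 : ℝ) : ℂ) / ((‖ξ‖ : ℝ) : ℂ) ^ 2 := by
    rw [mul_pow, hE]
    push_cast
    rw [show (3 * -(l : ℂ) ^ 2) = (l : ℂ) ^ 2 * (3 * -1) by ring,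
      mul_div_mul_left _ _ (pow_ne_zero 2 hl')]
  rw [nvPhase, nvPhase, nvSymbol, nvSymbol, hn, hq]
  simp only [Complex.real_smul, map_mul, map_div₀, map_pow, Complex.conj_ofReal]
  field_simp

open scoped Pointwise in
lemma nvTruncatedIntegral_scaling {α β E t l : ℝ} (hl : 0 < l) (hE : E = -l ^ 2) (u : ℂ) (R : ℝ) :
    nvTruncatedIntegral α β E t u R =
      (l : ℂ) ^ 2 * (l : ℂ) ^ ((α : ℂ) + Complex.I * (β : ℂ)) *
        nvTruncatedIntegral α β (-1) (t * l ^ 3) (u / (l : ℂ) ^ 2) (R / l) := by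
  have h := Measure.setIntegral_comp_smul_of_pos volume (nvIntegrand α β E t u)
    (Metric.ball (0 : ℂ) (R / l)) hl
  have hb : l • Metric.ball (0 : ℂ) (R / l) = Metric.ball 0 R := by
    rw [smul_ball hl.ne', smul_zero, Real.norm_of_nonneg hl.le, mul_div_cancel₀ R hl.ne']
  have hI : ∀ ξ : ℂ, nvIntegrand α β E t u (l • ξ) =
      (l : ℂ) ^ ((α : ℂ) + Complex.I * (β : ℂ)) *
        nvIntegrand α β (-1) (t * l ^ 3) (u / (l : ℂ) ^ 2) ξ := by
    intro ξ
    rw [nvIntegrand, nvIntegrand, nvPhase_smul hl hE, norm_smul, Real.norm_of_nonneg hl.le,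
      Complex.ofReal_mul, Complex.mul_cpow_ofReal_nonneg hl.le (norm_nonneg _)]
    push_cast
    ring_nf
  simp only [hI, hb, Complex.finrank_real_complex, integral_const_mul] at h
  have hl' : (l : ℂ) ≠ 0 := by exact_mod_cast hl.ne'
  rw [nvTruncatedIntegral, nvTruncatedIntegral, mul_assoc, h, Complex.real_smul]
  push_cast
  field_simp

theorem lemma2p1 (α : ℝ) (hα₀ : 0 ≤ α) (hα₁ : α < 1) :
    ∃ ε₀ : ℝ, 0 < ε₀ ∧ ∀ ε : ℝ, 0 < ε → ε < ε₀ →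
      ∃ C : ℝ, 0 < C ∧ ∀ (β t : ℝ), 0 < t → ∀ u : ℂ,
        -- the case of energy `-1`
        (Tendsto (nvTruncatedIntegral α β (-1) t u) atTop
            (𝓝 (nvOscillatoryIntegral α β (-1) t u)) ∧
          ‖nvOscillatoryIntegral α β (-1) t u‖ ≤
            C * ((1 + |β|) / t ^ ((α + 3) / 4 - ε))) ∧
        -- arbitrary negative energy, with the same constant
        ∀ E : ℝ, E < 0 →
          Tendsto (nvTruncatedIntegral α β E t u) atTop
              (𝓝 (nvOscillatoryIntegral α β E t u)) ∧
            ‖nvOscillatoryIntegral α β E t u‖ ≤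
              C * ((1 + |β|) * |E| ^ ((α - 1) / 8 + 3 * ε / 2) / t ^ ((α + 3) / 4 - ε)) := by
  -- The threshold is exactly the tail condition `2 + α < 3κ`; the other constraints on `κ` then
  -- follow.
  refine ⟨(1 - α) / 12, by linarith, fun ε hε hε₀ => ?_⟩
  set κ := (α + 3) / 4 - ε with hκ
  obtain ⟨C, hC, hmain⟩ := exists_limit_energy_neg_one (κ := κ) hα₀ hα₁ (by linarith)
    (by linarith) (by linarith) (by linarith) (by linarith)
  refine ⟨C, hC, fun β t ht u => ⟨?_, fun E hE => ?_⟩⟩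
  · obtain ⟨I, hI, hIn⟩ := hmain β t ht u
    rw [nvOscillatoryIntegral, hI.limUnder_eq]
    exact ⟨hI, hIn⟩
  · set l := √(-E)
    have hl : 0 < l := Real.sqrt_pos.2 (by linarith)
    have hEl : E = -l ^ 2 := by rw [Real.sq_sqrt (by linarith)]; ring
    obtain ⟨I, hI, hIn⟩ := hmain β (t * l ^ 3) (by positivity) (u / (l : ℂ) ^ 2)
    have hT : Tendsto (nvTruncatedIntegral α β E t u) atTop
        (𝓝 ((l : ℂ) ^ 2 * (l : ℂ) ^ ((α : ℂ) + Complex.I * (β : ℂ)) * I)) := by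
      refine ((hI.comp (tendsto_id.atTop_div_const hl)).const_mul _).congr fun R => ?_
      exact (nvTruncatedIntegral_scaling hl hEl u R).symm
    rw [nvOscillatoryIntegral, hT.limUnder_eq]
    refine ⟨hT, ?_⟩
    have habs : |E| = l ^ 2 := by rw [hEl, abs_neg, abs_of_nonneg (sq_nonneg l)]
    -- With `|E| = l²` the exponent of `|E|` is `(2 + α - 3κ) / 2`; the three contributions are the
    -- area element, the amplitude and the rescaled time `t l³`.
    have hpow : l ^ 2 * l ^ α / (l ^ 3) ^ κ = |E| ^ ((α - 1) / 8 + 3 * ε / 2) := by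
      rw [habs, ← Real.rpow_natCast l 2, ← Real.rpow_natCast l 3, ← Real.rpow_mul hl.le,
        ← Real.rpow_mul hl.le, ← Real.rpow_add hl, ← Real.rpow_sub hl]
      congr 1
      push_cast
      rw [hκ]
      ring
    have hn : ‖(l : ℂ) ^ 2 * (l : ℂ) ^ ((α : ℂ) + Complex.I * (β : ℂ))‖ = l ^ 2 * l ^ α := by
      rw [norm_mul, Complex.norm_cpow_eq_rpow_re_of_pos hl, norm_pow, Complex.norm_real,
        Real.norm_of_nonneg hl.le]
      simp
    rw [norm_mul, hn, ← hpow]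
    calc _ ≤ l ^ 2 * l ^ α * (C * ((1 + |β|) / (t * l ^ 3) ^ κ)) := by gcongr
      _ = _ := by
        rw [Real.mul_rpow ht.le (by positivity)]
        field_simp
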